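/- Consider pure states (unit vectors) of finite-dimensional bipartite systems $\mathbb C^{d_A}\otimes\mathbb C^{d_B}$ shared by Alice and Bob. Write $\phi\to\psi$ if some LOCC protocol (finitely many rounds, each a local measurement of one party with finitely many Kraus operators $K_i$, $\sum_i K_i^\dagger K_i=I$, followed by classical communication of the outcome) transforms $|\phi\rangle\langle\phi|$ into $|\psi\rangle\langle\psi|$ with certainty. The states are *equivalent* if they have the same ordered Schmidt coefficients (padded by zeros), *incomparable* if neither $\phi\to\psi$ nor $\psi\to\phi$, and a state is *entangled* if it is not a product vector $x\otimes y$. Tensor products $\phi\otimes\psi$ are taken with Alice holding the first and Bob the second subsystem of both factors. For $d\ge 2$ let $\mathcal P_d$ be the set of all $2\times d$ dimensional pure states and all their finite tensor products. For states $\phi,\psi$ put $$L(\phi|\psi)=\{\tfrac mn:\ n,m\in\mathbb Z_{>0},\ \phi^{\otimes n}\to\psi^{\otimes m}\},\qquad U(\phi|\psi)=\{\tfrac mn:\ n,m\in\mathbb Z_{>0},\ \psi^{\otimes m}\to\phi^{\otimes n}\}.$$ Then, under deterministic LOCC, $\mathcal P_d$ is only partially ordered: 1. The relation $\to$ on bipartite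 pure states (in particular on $\mathcal P_d$) is reflexive and transitive, and $\phi\to\psi$ and $\psi\to\phi$ both hold if and only if $\phi$ and $\psi$ are equivalent. So $\to$ is a partial order up to equivalence. 2. For every $d\ge2$ this order is not total on $\mathcal P_d$: there are incomparable states in $\mathcal P_d$. 3. Let $\phi$ and $\psi$ be inequivalent entangled pure states of a $2\times d$ and a $2\times d'$ dimensional system. Then $L(\phi|\psi)$ and $U(\phi|\psi)$ are non-empty and bounded, from above and from below respectively, and $$\sup L(\phi|\psi)<\inf U(\phi|\psi).$$ There are positive integers $n,m$ with $\sup L(\phi|\psi)<\frac mn<\inf U(\phi|\psi)$, and for all such $n,m$ the states $\phi^{\otimes n}$ and $\psi^{\otimes m}$ are incomparable. 4. Consequently no entropy can be defined as a Dedekind cut: for every $d\ge2$ and every reference state $e\in\mathcal P_d$ there is no real-valued function $S$ of states such that $S(\phi)=\sup L(\phi|e)=\inf U(\phi|e)$ (supremum and infimum in $\mathbb R$) for all entangled $2\times d$ dimensional pure states $\phi$. -/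

import Mathlib

open scoped Matrix Kronecker

noncomputable section

/-- A pure state (unit vector) of a finite-dimensional bipartite system
`ℂ^dimA ⊗ ℂ^dimB`, given by its amplitudes in the product basis. -/
structure PureState where
  dimA : ℕ
  dimB : ℕ
  amp : Matrix (Fin dimA) (Fin dimB) ℂ
  norm_one : ∑ i, ∑ j, ‖amp i j‖ ^ 2 = 1

/-- A (finite) protocol of local operations and classical communication, from an `a × b` system to
an `a' × b'` system. Either the protocol stops, or one of the two parties performs a measurement on
her or his own subsystem with Kraus operators `K i`, where `∑ i, (K i)ᴴ * K i = 1`, communicates the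
outcome `i`, and the parties go on with a protocol that may depend on `i`.
The Kraus operators may change the dimension of the local system (local ancillas and partial
traces are allowed), and a local operation with several Kraus operators for one message is
obtained by letting the continuation ignore part of the outcome. -/
inductive LOCC (a' b' : ℕ) : ℕ → ℕ → Type
  | done : LOCC a' b' a' b'
  | alice {a b : ℕ} (r : ℕ) (c : Fin r → ℕ) (K : (i : Fin r) → Matrix (Fin (c i)) (Fin a) ℂ)
      (hK : ∑ i, (K i)ᴴ * K i = 1) (next : (i : Fin r) → LOCC a' b' (c i) b) : LOCC a' b' a b
  | bob {a b : ℕ} (r : ℕ) (c : Fin r → ℕ) (K : (i : Fin r) → Matrix (Fin (c i)) (Fin b) ℂ)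
      (hK : ∑ i, (K i)ᴴ * K i = 1) (next : (i : Fin r) → LOCC a' b' a (c i)) : LOCC a' b' a b

/-- The deterministic quantum operation on density matrices that is implemented by an LOCC protocol
(averaged over all measurement outcomes). -/
def LOCC.apply {a' b' : ℕ} : {a b : ℕ} → LOCC a' b' a b →
    Matrix (Fin a × Fin b) (Fin a × Fin b) ℂ → Matrix (Fin a' × Fin b') (Fin a' × Fin b') ℂ
  | _, _, .done, ρ => ρ
  | _, b, .alice _ _ K _ next, ρ =>
      ∑ i, (next i).apply
        ((K i ⊗ₖ (1 : Matrix (Fin b) (Fin b) ℂ)) * ρ * (K i ⊗ₖ (1 : Matrix (Fin b) (Fin b) ℂ))ᴴ)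
  | a, _, .bob _ _ K _ next, ρ =>
      ∑ i, (next i).apply
        (((1 : Matrix (Fin a) (Fin a) ℂ) ⊗ₖ K i) * ρ * ((1 : Matrix (Fin a) (Fin a) ℂ) ⊗ₖ K i)ᴴ)

namespace PureState

/-- The rank-one density matrix `|φ⟩⟨φ|`. -/
def density (φ : PureState) :
    Matrix (Fin φ.dimA × Fin φ.dimB) (Fin φ.dimA × Fin φ.dimB) ℂ :=
  Matrix.vecMulVec (fun p => φ.amp p.1 p.2) (star fun p => φ.amp p.1 p.2)

/-- `φ → ψ`: some LOCC protocol transforms `φ` into `ψ` with certainty. -/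
def ConvertsTo (φ ψ : PureState) : Prop :=
  ∃ P : LOCC ψ.dimA ψ.dimB φ.dimA φ.dimB, P.apply φ.density = ψ.density

/-- Neither state can be transformed into the other by deterministic LOCC. -/
def Incomparable (φ ψ : PureState) : Prop :=
  ¬ φ.ConvertsTo ψ ∧ ¬ ψ.ConvertsTo φ

/-- A pure state is entangled if it is not a product of a vector of Alice and a vector of Bob. -/
def Entangled (φ : PureState) : Prop :=
  ¬ ∃ (x : Fin φ.dimA → ℂ) (y : Fin φ.dimB → ℂ), ∀ i j, φ.amp i j = x i * y j

/-- The ordered Schmidt coefficients `λ₀ ≥ λ₁ ≥ …`, extended by zeros: the eigenvalues, in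
decreasing order, of Alice's reduced density matrix. -/
def schmidt (φ : PureState) (k : ℕ) : ℝ :=
  if h : k < Fintype.card (Fin φ.dimA) then
    (Matrix.isHermitian_mul_conjTranspose_self φ.amp).eigenvalues₀ ⟨k, h⟩
  else 0

/-- Equivalent states have the same Schmidt coefficients. -/
def Equivalent (φ ψ : PureState) : Prop :=
  φ.schmidt = ψ.schmidt

theorem tensor_norm_sq {a b c d : ℕ} (M : Matrix (Fin a) (Fin b) ℂ) (N : Matrix (Fin c) (Fin d) ℂ) :
    ∑ i, ∑ j, ‖Matrix.reindex finProdFinEquiv finProdFinEquiv (M ⊗ₖ N) i j‖ ^ 2 =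
      (∑ i, ∑ j, ‖M i j‖ ^ 2) * ∑ i, ∑ j, ‖N i j‖ ^ 2 := by
  rw [← (finProdFinEquiv (m := a) (n := c)).sum_comp]
  simp_rw [← (finProdFinEquiv (m := b) (n := d)).sum_comp]
  simp only [Matrix.reindex_apply, Matrix.submatrix_apply, Equiv.symm_apply_apply,
    Matrix.kroneckerMap_apply, norm_mul, mul_pow, Fintype.sum_prod_type, Finset.sum_mul_sum]

/-- The tensor product `φ ⊗ ψ`, as a state of the bipartite system in which Alice holds the first
subsystems of `φ` and `ψ` and Bob the second ones. -/
def tensor (φ ψ : PureState) : PureState where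
  dimA := φ.dimA * ψ.dimA
  dimB := φ.dimB * ψ.dimB
  amp := Matrix.reindex finProdFinEquiv finProdFinEquiv (φ.amp ⊗ₖ ψ.amp)
  norm_one := by rw [tensor_norm_sq, φ.norm_one, ψ.norm_one, one_mul]

/-- The `n`-fold tensor power `φ^{⊗n}` (for `n = 0` the state of the trivial system). -/
def pow (φ : PureState) : ℕ → PureState
  | 0 => { dimA := 1, dimB := 1, amp := 1, norm_one := by simp }
  | n + 1 => (φ.pow n).tensor φ

/-- The `2 × d` dimensional pure states together with all their finite tensor products. -/
inductive IsTwoByTensor (d : ℕ) : PureState → Prop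
  | single (φ : PureState) (hA : φ.dimA = 2) (hB : φ.dimB = d) : IsTwoByTensor d φ
  | tensor (φ ψ : PureState) (hφ : IsTwoByTensor d φ) (hψ : IsTwoByTensor d ψ) :
      IsTwoByTensor d (φ.tensor ψ)

/-- `L(φ|ψ) = {m / n : φ^{⊗n} → ψ^{⊗m}}`, with `n` and `m` positive integers. -/
def lowerSet (φ ψ : PureState) : Set ℝ :=
  {x | ∃ n m : ℕ, 0 < n ∧ 0 < m ∧ x = (m : ℝ) / n ∧ (φ.pow n).ConvertsTo (ψ.pow m)}

/-- `U(φ|ψ) = {m / n : ψ^{⊗m} → φ^{⊗n}}`, with `n` and `m` positive integers. -/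
def upperSet (φ ψ : PureState) : Set ℝ :=
  {x | ∃ n m : ℕ, 0 < n ∧ 0 < m ∧ x = (m : ℝ) / n ∧ (ψ.pow m).ConvertsTo (φ.pow n)}

/-- The number `s` is the Dedekind cut of `L(φ|e)` and `U(φ|e)`: `s = sup L(φ|e) = inf U(φ|e)`. -/
def IsDedekindCut (φ e : PureState) (s : ℝ) : Prop :=
  IsLUB (φ.lowerSet e) s ∧ IsGLB (φ.upperSet e) s

end PureState

end

/-! Everything rests on two LOCC monotones that are multiplicative under tensor products: the
Schmidt rank, and the largest Schmidt coefficient `schmidt 0`. If `φ^{⊗n} → ψ^{⊗m}`, then `m / n` is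
at most both the ratio of the log ranks and the ratio of the values `-log (schmidt 0)`; for the
reverse conversion it is at least both (`ConvertsTo.rate_le`). So `sup L ≤ min < max ≤ inf U`
whenever the two ratios differ. Entangled states with `dimA = 2` all have rank 2, so the first ratio
is 1; the second is 1 only if the largest coefficients agree, and these determine the states up to
equivalence.

Monotonicity comes from low-rank approximation. A protocol acts as a sum of local maps `M ↦ A l * M
* B l`; a pure output forces every branch to be a multiple of it. The weight outside the `k` largest
Schmidt coefficients is the squared distance to the matrices of rank at most `k`. The branches
preserve total squared norm and do not raise rank, so this weight cannot grow
(`ConvertsTo.sum_schmidt_le`). Antisymmetry up to equivalence follows.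

Protocols are built by `Reaches.of_mixture`: Alice measures, Bob corrects. This gives conversion
between equivalent states, and from any state with `schmidt 0 ≤ 1 / 2` to any state with `dimA = 2`.
High powers of an entangled state satisfy that bound, so `L` and `U` are non-empty.

A Dedekind cut would force the two ratios to coincide for every `φ`, fixing `schmidt 0` of all
entangled `2 × d` states in terms of the reference. -/

noncomputable section

/-! ### Pure density matrices under local operators -/

/-- The unnormalized pure density matrix of the amplitude matrix `M`. -/
def pureDensity {a b : ℕ} (M : Matrix (Fin a) (Fin b) ℂ) :
    Matrix (Fin a × Fin b) (Fin a × Fin b) ℂ :=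
  Matrix.vecMulVec (fun p => M p.1 p.2) (star fun p => M p.1 p.2)

theorem pureDensity_apply {a b : ℕ} (M : Matrix (Fin a) (Fin b) ℂ) (p q : Fin a × Fin b) :
    pureDensity M p q = M p.1 p.2 * star (M q.1 q.2) := rfl

theorem PureState.density_eq (φ : PureState) : φ.density = pureDensity φ.amp := rfl

/-- The squared Frobenius norm. -/
def frobSq {m n : Type*} [Fintype m] [Fintype n] (M : Matrix m n ℂ) : ℝ :=
  ∑ i, ∑ j, ‖M i j‖ ^ 2

theorem frobSq_nonneg {m n : Type*} [Fintype m] [Fintype n] (M : Matrix m n ℂ) :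
    0 ≤ frobSq M := by unfold frobSq; positivity

theorem frobSq_smul {m n : Type*} [Fintype m] [Fintype n] (c : ℂ) (M : Matrix m n ℂ) :
    frobSq (c • M) = ‖c‖ ^ 2 * frobSq M := by
  simp [frobSq, mul_pow, Finset.mul_sum]

theorem trace_mul_conjTranspose {m n : Type*} [Fintype m] [Fintype n] (M : Matrix m n ℂ) :
    (M * Mᴴ).trace = (frobSq M : ℂ) := by
  simp [Matrix.trace, Matrix.mul_apply, frobSq, Complex.mul_conj, Complex.normSq_eq_norm_sq]

theorem trace_pureDensity {a b : ℕ} (M : Matrix (Fin a) (Fin b) ℂ) :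
    (pureDensity M).trace = (frobSq M : ℂ) := by
  simp [Matrix.trace, pureDensity_apply, Fintype.sum_prod_type, frobSq, Complex.mul_conj,
    Complex.normSq_eq_norm_sq]

theorem pureDensity_smul {a b : ℕ} (c : ℂ) (M : Matrix (Fin a) (Fin b) ℂ) :
    pureDensity (c • M) = ((‖c‖ ^ 2 : ℝ) : ℂ) • pureDensity M := by
  ext p q
  simp only [pureDensity_apply, Matrix.smul_apply, smul_eq_mul, star_mul', Complex.ofReal_pow,
    ← Complex.mul_conj', Complex.star_def]
  ring

theorem pureDensity_zero {a b : ℕ} : pureDensity (0 : Matrix (Fin a) (Fin b) ℂ) = 0 := by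
  ext p q
  simp [pureDensity_apply]

theorem sandwich_pureDensity {a b c d : ℕ} (M : Matrix (Fin a) (Fin b) ℂ)
    (N : Matrix (Fin c) (Fin d) ℂ) (T : Matrix (Fin c × Fin d) (Fin a × Fin b) ℂ)
    (h : ∀ p, ∑ q, T p q * M q.1 q.2 = N p.1 p.2) :
    T * pureDensity M * Tᴴ = pureDensity N := by
  rw [pureDensity, Matrix.mul_vecMulVec, Matrix.vecMulVec_mul]
  have h' : T *ᵥ (fun p => M p.1 p.2) = fun p => N p.1 p.2 := by
    ext p; exact h p
  rw [← Matrix.star_mulVec, h', pureDensity]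

theorem alice_pureDensity {a b c : ℕ} (K : Matrix (Fin c) (Fin a) ℂ)
    (M : Matrix (Fin a) (Fin b) ℂ) :
    (K ⊗ₖ (1 : Matrix (Fin b) (Fin b) ℂ)) * pureDensity M *
      (K ⊗ₖ (1 : Matrix (Fin b) (Fin b) ℂ))ᴴ = pureDensity (K * M) := by
  apply sandwich_pureDensity
  rintro ⟨i, j⟩
  simp [Fintype.sum_prod_type, Matrix.kroneckerMap_apply, Matrix.one_apply, Matrix.mul_apply]

theorem bob_pureDensity {a b c : ℕ} (K : Matrix (Fin c) (Fin b) ℂ)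
    (M : Matrix (Fin a) (Fin b) ℂ) :
    ((1 : Matrix (Fin a) (Fin a) ℂ) ⊗ₖ K) * pureDensity M *
      ((1 : Matrix (Fin a) (Fin a) ℂ) ⊗ₖ K)ᴴ = pureDensity (M * Kᵀ) := by
  apply sandwich_pureDensity
  rintro ⟨i, j⟩
  simp [Fintype.sum_prod_type, Matrix.kroneckerMap_apply, Matrix.one_apply, Matrix.mul_apply,
    mul_comm]

/-! ### Protocols as additive, trace-preserving, separable maps -/

namespace LOCC

theorem apply_zero {a' b' a b : ℕ} (P : LOCC a' b' a b) : P.apply 0 = 0 := by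
  induction P with
  | done => rfl
  | alice r c K hK next ih => simp [LOCC.apply, ih]
  | bob r c K hK next ih => simp [LOCC.apply, ih]

theorem apply_add {a' b' a b : ℕ} (P : LOCC a' b' a b)
    (ρ σ : Matrix (Fin a × Fin b) (Fin a × Fin b) ℂ) :
    P.apply (ρ + σ) = P.apply ρ + P.apply σ := by
  induction P with
  | done => rfl
  | alice r c K hK next ih => simp [LOCC.apply, ih, Matrix.mul_add, Matrix.add_mul,
    Finset.sum_add_distrib]
  | bob r c K hK next ih => simp [LOCC.apply, ih, Matrix.mul_add, Matrix.add_mul,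
    Finset.sum_add_distrib]

theorem apply_sum {a' b' a b : ℕ} (P : LOCC a' b' a b) {ι : Type*} (s : Finset ι)
    (ρ : ι → Matrix (Fin a × Fin b) (Fin a × Fin b) ℂ) :
    P.apply (∑ i ∈ s, ρ i) = ∑ i ∈ s, P.apply (ρ i) :=
  map_sum (⟨⟨P.apply, P.apply_zero⟩, P.apply_add⟩ :
    Matrix (Fin a × Fin b) (Fin a × Fin b) ℂ →+ Matrix (Fin a' × Fin b') (Fin a' × Fin b') ℂ) ρ s

/-- Sequential composition of protocols. -/
def comp {a' b' a'' b'' : ℕ} (Q : LOCC a'' b'' a' b') : {a b : ℕ} → LOCC a' b' a b →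
    LOCC a'' b'' a b
  | _, _, .done => Q
  | _, _, .alice r c K hK next => .alice r c K hK fun i => comp Q (next i)
  | _, _, .bob r c K hK next => .bob r c K hK fun i => comp Q (next i)

theorem comp_apply {a' b' a'' b'' a b : ℕ} (Q : LOCC a'' b'' a' b') (P : LOCC a' b' a b)
    (ρ : Matrix (Fin a × Fin b) (Fin a × Fin b) ℂ) :
    (Q.comp P).apply ρ = Q.apply (P.apply ρ) := by
  induction P with
  | done => rfl
  | alice r c K hK next ih => simp [LOCC.apply, comp, ih, apply_sum]
  | bob r c K hK next ih => simp [LOCC.apply, comp, ih, apply_sum]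

theorem trace_sum_conj {r : ℕ} {m : Type*} [Fintype m] [DecidableEq m] {n : Fin r → Type*}
    [∀ i, Fintype (n i)] (K : (i : Fin r) → Matrix (n i) m ℂ) (hK : ∑ i, (K i)ᴴ * K i = 1)
    (ρ : Matrix m m ℂ) : ∑ i, (K i * ρ * (K i)ᴴ).trace = ρ.trace := by
  simp_rw [Matrix.trace_mul_comm _ (K _)ᴴ, ← Matrix.mul_assoc, ← Matrix.trace_sum,
    ← Finset.sum_mul, hK, one_mul]

theorem trace_apply {a' b' a b : ℕ} (P : LOCC a' b' a b)
    (ρ : Matrix (Fin a × Fin b) (Fin a × Fin b) ℂ) : (P.apply ρ).trace = ρ.trace := by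
  induction P with
  | done => rfl
  | alice r c K hK next ih =>
    simp only [LOCC.apply, Matrix.trace_sum, ih]
    apply trace_sum_conj
    simp_rw [Matrix.conjTranspose_kronecker, ← Matrix.mul_kronecker_mul, Matrix.conjTranspose_one,
      one_mul]
    rw [← Matrix.one_kronecker_one, ← hK]
    ext p q
    simp [Matrix.sum_apply, Matrix.kroneckerMap_apply, Finset.sum_mul]
  | bob r c K hK next ih =>
    simp only [LOCC.apply, Matrix.trace_sum, ih]
    apply trace_sum_conj
    simp_rw [Matrix.conjTranspose_kronecker, ← Matrix.mul_kronecker_mul, Matrix.conjTranspose_one,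
      one_mul]
    rw [← Matrix.one_kronecker_one, ← hK]
    ext p q
    simp [Matrix.sum_apply, Matrix.kroneckerMap_apply, Finset.mul_sum]

/-- An LOCC protocol is a separable operation. -/
theorem exists_separable {a' b' a b : ℕ} (P : LOCC a' b' a b) :
    ∃ (ι : Type) (_ : Fintype ι) (A : ι → Matrix (Fin a') (Fin a) ℂ)
      (B : ι → Matrix (Fin b) (Fin b') ℂ), ∀ M : Matrix (Fin a) (Fin b) ℂ,
        P.apply (pureDensity M) = ∑ l, pureDensity (A l * M * B l) := by
  induction P with
  | done => exact ⟨Unit, inferInstance, fun _ => 1, fun _ => 1, fun M => by simp [LOCC.apply]⟩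
  | alice r c K hK next ih =>
    choose ι hι A B h using ih
    refine ⟨Σ i, ι i, inferInstance, fun l => A l.1 l.2 * K l.1, fun l => B l.1 l.2, fun M => ?_⟩
    simp only [LOCC.apply, alice_pureDensity, h, Fintype.sum_sigma]
    simp only [Matrix.mul_assoc]
  | bob r c K hK next ih =>
    choose ι hι A B h using ih
    refine ⟨Σ i, ι i, inferInstance, fun l => A l.1 l.2, fun l => (K l.1)ᵀ * B l.1 l.2,
      fun M => ?_⟩
    simp only [LOCC.apply, bob_pureDensity, h, Fintype.sum_sigma]
    simp only [Matrix.mul_assoc]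

end LOCC

/-- Pure states are extremal: for `x` orthogonal to `N`, the nonnegative numbers `|⟨x, L l⟩|²` sum
to `|⟨x, N⟩|² = 0`, so each `L l` lies on the line through `N`. -/
theorem exists_smul_of_sum_pureDensity {a b : ℕ} {ι : Type*} [Fintype ι]
    (L : ι → Matrix (Fin a) (Fin b) ℂ) (N : Matrix (Fin a) (Fin b) ℂ) (hN : frobSq N = 1)
    (h : ∑ l, pureDensity (L l) = pureDensity N) :
    ∃ c : ι → ℂ, (∀ l, L l = c l • N) ∧ ∑ l, ‖c l‖ ^ 2 = 1 := by
  have key : ∀ x : Fin a × Fin b → ℂ, ∑ p, star (x p) * N p.1 p.2 = 0 → ∀ l,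
      ∑ p, star (x p) * L l p.1 p.2 = 0 := by
    intro x hx
    have hq : ∀ M : Matrix (Fin a) (Fin b) ℂ,
        ∑ p, ∑ q, star (x p) * pureDensity M p q * x q =
          ((‖∑ p, star (x p) * M p.1 p.2‖ ^ 2 : ℝ) : ℂ) := by
      intro M
      rw [Complex.ofReal_pow, ← Complex.mul_conj', map_sum, Finset.sum_mul_sum]
      refine Finset.sum_congr rfl fun p _ => Finset.sum_congr rfl fun q _ => ?_
      simp [pureDensity_apply]
      ring
    have h1 : ∑ l, ‖∑ p, star (x p) * L l p.1 p.2‖ ^ 2 = 0 := by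
      have h2 := hq N
      rw [hx, ← h] at h2
      simp only [Matrix.sum_apply, Finset.mul_sum, Finset.sum_mul] at h2
      have h3 : ∑ l, ∑ p, ∑ q, star (x p) * pureDensity (L l) p q * x q = 0 := by
        rw [Finset.sum_comm]
        simp_rw [Finset.sum_comm (s := (Finset.univ : Finset ι))]
        simpa using h2
      simp_rw [hq] at h3
      exact_mod_cast h3
    intro l
    rw [Finset.sum_eq_zero_iff_of_nonneg (fun _ _ => by positivity)] at h1
    simpa using h1 l (Finset.mem_univ _)
  have hNN : ∑ p : Fin a × Fin b, star (N p.1 p.2) * N p.1 p.2 = 1 := by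
    have := trace_pureDensity N
    rw [hN] at this
    simpa [Matrix.trace, pureDensity_apply, mul_comm] using this
  let c : ι → ℂ := fun l => ∑ p : Fin a × Fin b, star (N p.1 p.2) * L l p.1 p.2
  have hc : ∀ l, L l = c l • N := by
    intro l
    ext i j
    -- The test vector is the component of the basis vector at `(i, j)` orthogonal to `N`.
    have := key (fun p => (if p = (i, j) then 1 else 0) - star (N i j) * N p.1 p.2) (by
      simp only [star_sub, star_mul', star_star, sub_mul, Finset.sum_sub_distrib, mul_assoc,
        ← Finset.mul_sum, hNN]
      simp) l
    simp only [star_sub, star_mul', star_star, sub_mul, Finset.sum_sub_distrib, mul_assoc,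
        ← Finset.mul_sum] at this
    simp only [apply_ite, star_one, star_zero, ite_mul, one_mul, zero_mul, Finset.sum_ite_eq',
      Finset.mem_univ, if_true] at this
    rw [Matrix.smul_apply, smul_eq_mul, mul_comm, ← sub_eq_zero]
    simpa [c] using this
  refine ⟨c, hc, ?_⟩
  have h1 := congrArg Matrix.trace h
  simp only [Matrix.trace_sum, hc, trace_pureDensity, frobSq_smul, hN, mul_one] at h1
  exact_mod_cast h1

/-- Trace preservation, for arbitrary `M`: it will be applied to the difference of a state and its
low-rank approximation. -/
theorem frobSq_separable {a' b' a b : ℕ} (P : LOCC a' b' a b) {ι : Type*} [Fintype ι]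
    (A : ι → Matrix (Fin a') (Fin a) ℂ) (B : ι → Matrix (Fin b) (Fin b') ℂ)
    (h : ∀ M, P.apply (pureDensity M) = ∑ l, pureDensity (A l * M * B l))
    (M : Matrix (Fin a) (Fin b) ℂ) : ∑ l, frobSq (A l * M * B l) = frobSq M := by
  have h1 := congrArg Matrix.trace (h M)
  simp only [LOCC.trace_apply, Matrix.trace_sum, trace_pureDensity] at h1
  exact_mod_cast h1.symm

namespace PureState

theorem frobSq_amp (φ : PureState) : frobSq φ.amp = 1 := φ.norm_one

/-- A deterministic LOCC transformation of pure states, in terms of a norm preserving family of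
local maps, each of which sends the initial state to a multiple of the final state. -/
theorem ConvertsTo.exists_local {φ ψ : PureState} (h : φ.ConvertsTo ψ) :
    ∃ (ι : Type) (_ : Fintype ι) (A : ι → Matrix (Fin ψ.dimA) (Fin φ.dimA) ℂ)
      (B : ι → Matrix (Fin φ.dimB) (Fin ψ.dimB) ℂ) (c : ι → ℂ),
      (∀ l, A l * φ.amp * B l = c l • ψ.amp) ∧ ∑ l, ‖c l‖ ^ 2 = 1 ∧
      ∀ M : Matrix (Fin φ.dimA) (Fin φ.dimB) ℂ, ∑ l, frobSq (A l * M * B l) = frobSq M := by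
  obtain ⟨P, hP⟩ := h
  obtain ⟨ι, hι, A, B, hAB⟩ := P.exists_separable
  rw [density_eq, density_eq, hAB] at hP
  obtain ⟨c, hc, hc1⟩ := exists_smul_of_sum_pureDensity _ _ ψ.frobSq_amp hP
  exact ⟨ι, hι, A, B, c, hc, hc1, frobSq_separable P A B hAB⟩

theorem ConvertsTo.rank_le {φ ψ : PureState} (h : φ.ConvertsTo ψ) :
    ψ.amp.rank ≤ φ.amp.rank := by
  obtain ⟨ι, _, A, B, c, hc, hc1, -⟩ := h.exists_local
  obtain ⟨l, hl⟩ : ∃ l, c l ≠ 0 := by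
    by_contra! h0
    simp [h0] at hc1
  have : ψ.amp = ((c l)⁻¹ • A l) * φ.amp * B l := by
    rw [Matrix.smul_mul, Matrix.smul_mul, hc, smul_smul, inv_mul_cancel₀ hl, one_smul]
  rw [this]
  exact (Matrix.rank_mul_le_left _ _).trans (Matrix.rank_mul_le_right _ _)

theorem convertsTo_refl (φ : PureState) : φ.ConvertsTo φ := ⟨.done, rfl⟩

theorem ConvertsTo.trans {φ ψ χ : PureState} (h₁ : φ.ConvertsTo ψ) (h₂ : ψ.ConvertsTo χ) :
    φ.ConvertsTo χ := by
  obtain ⟨P, hP⟩ := h₁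
  obtain ⟨Q, hQ⟩ := h₂
  exact ⟨Q.comp P, by rw [LOCC.comp_apply, hP, hQ]⟩

end PureState

/-! ### Schmidt decomposition and isometries -/

section SingularValues

variable {m n : Type*} [Fintype m] [Fintype n]

theorem frobSq_eq_trace_re (M : Matrix m n ℂ) : frobSq M = (M * Mᴴ).trace.re := by
  rw [trace_mul_conjTranspose, Complex.ofReal_re]

theorem frobSq_mul_of_isometry {k : Type*} [Fintype k] [DecidableEq k] (W : Matrix m k ℂ)
    (hW : Wᴴ * W = 1) (M : Matrix k n ℂ) : frobSq (W * M) = frobSq M := by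
  rw [frobSq_eq_trace_re, frobSq_eq_trace_re, Matrix.conjTranspose_mul, Matrix.mul_assoc,
    Matrix.trace_mul_comm, Matrix.mul_assoc, Matrix.mul_assoc, hW, Matrix.mul_one]

variable [DecidableEq m]

theorem frobSq_add_frobSq_of_isometry {k : Type*} [Fintype k] [DecidableEq k] (W : Matrix m k ℂ)
    (hW : Wᴴ * W = 1) (M : Matrix m n ℂ) :
    frobSq (Wᴴ * M) + frobSq ((1 - W * Wᴴ) * M) = frobSq M := by
  have h1 : (1 - W * Wᴴ)ᴴ * (1 - W * Wᴴ) = 1 - W * Wᴴ := by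
    have : W * Wᴴ * (W * Wᴴ) = W * Wᴴ := by
      rw [Matrix.mul_assoc, ← Matrix.mul_assoc Wᴴ, hW, Matrix.one_mul]
    simp [Matrix.conjTranspose_sub, Matrix.conjTranspose_mul, mul_sub, sub_mul, this]
  have h2 : frobSq (Wᴴ * M) = (W * Wᴴ * (M * Mᴴ)).trace.re := by
    rw [frobSq_eq_trace_re, Matrix.conjTranspose_mul, Matrix.conjTranspose_conjTranspose,
      ← Matrix.mul_assoc, Matrix.trace_mul_comm]
    simp only [Matrix.mul_assoc]
  have h3 : frobSq ((1 - W * Wᴴ) * M) = ((1 - W * Wᴴ) * (M * Mᴴ)).trace.re := by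
    rw [frobSq_eq_trace_re, Matrix.conjTranspose_mul, ← Matrix.mul_assoc, Matrix.trace_mul_comm,
      Matrix.mul_assoc (1 - W * Wᴴ) M, ← Matrix.mul_assoc, h1]
  rw [h2, h3, frobSq_eq_trace_re, ← Complex.add_re, ← Matrix.trace_add, ← Matrix.add_mul,
    add_sub_cancel, Matrix.one_mul]

/-- `M = W √s Z` with an isometry `W` and a coisometry `Z`. -/
def HasSchmidtForm {κ : Type*} [Fintype κ] [DecidableEq κ] [DecidableEq n] (M : Matrix m n ℂ)
    (s : κ → ℝ) : Prop :=
  ∃ (W : Matrix m κ ℂ) (Z : Matrix κ n ℂ), Wᴴ * W = 1 ∧ Z * Zᴴ = 1 ∧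
    M = W * Matrix.diagonal (fun k => (√(s k) : ℂ)) * Z

/-- The rows of `Uᴴ * M` are orthogonal with squared norms `s i`. Rows with `s i = 0` vanish and are
dropped; normalizing the others gives the coisometry. -/
theorem hasSchmidtForm_of_diagonalization [DecidableEq n] (M : Matrix m n ℂ) (U : Matrix m m ℂ)
    (s : m → ℝ) (hs : ∀ i, 0 ≤ s i) (hU : Uᴴ * U = 1)
    (h : M * Mᴴ = U * Matrix.diagonal (fun i => (s i : ℂ)) * Uᴴ) :
    HasSchmidtForm M (fun k : {i // s i ≠ 0} => s k) := by
  have hU' : U * Uᴴ = 1 := mul_eq_one_comm.mp hU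
  have hV : (Uᴴ * M) * (Uᴴ * M)ᴴ = Matrix.diagonal (fun i => (s i : ℂ)) := by
    rw [Matrix.conjTranspose_mul, Matrix.conjTranspose_conjTranspose, Matrix.mul_assoc,
      ← Matrix.mul_assoc M, h]
    simp only [Matrix.mul_assoc, hU, Matrix.mul_one]
    rw [← Matrix.mul_assoc, hU, Matrix.one_mul]
  set V := Uᴴ * M with hVdef
  have hMV : M = U * V := by rw [hVdef, ← Matrix.mul_assoc, hU', Matrix.one_mul]
  have hV0 : ∀ i, s i = 0 → ∀ j, V i j = 0 := by
    intro i hi j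
    have h1 := congrFun (congrFun hV i) i
    rw [Matrix.diagonal_apply_eq, hi, Matrix.mul_apply] at h1
    simp only [Matrix.conjTranspose_apply, Complex.star_def, Complex.mul_conj',
      Complex.ofReal_zero] at h1
    have h2 : ∑ j, ‖V i j‖ ^ 2 = 0 := by exact_mod_cast h1
    rw [Finset.sum_eq_zero_iff_of_nonneg (fun _ _ => by positivity)] at h2
    simpa using h2 j (Finset.mem_univ _)
  have hpos : ∀ k : {i // s i ≠ 0}, (√(s k) : ℂ) ≠ 0 := fun k => by
    have := Real.sqrt_pos.mpr (lt_of_le_of_ne (hs k) k.2.symm)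
    exact_mod_cast this.ne'
  let E : Matrix {i // s i ≠ 0} {i // s i ≠ 0} ℂ := Matrix.diagonal fun k => (√(s k) : ℂ)⁻¹
  let W : Matrix m {i // s i ≠ 0} ℂ := U.submatrix id Subtype.val
  let V' : Matrix {i // s i ≠ 0} n ℂ := V.submatrix Subtype.val id
  refine ⟨W, E * V', ?_, ?_, ?_⟩
  · simp only [W]
    rw [Matrix.conjTranspose_submatrix, ← Matrix.submatrix_mul _ _ _ _ _ Function.bijective_id, hU]
    exact Matrix.submatrix_one _ Subtype.val_injective
  · have h1 : V' * V'ᴴ = Matrix.diagonal (fun k : {i // s i ≠ 0} => (s k : ℂ)) := by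
      simp only [V']
      rw [Matrix.conjTranspose_submatrix, ← Matrix.submatrix_mul _ _ _ _ _ Function.bijective_id,
        hV]
      exact Matrix.submatrix_diagonal _ _ Subtype.val_injective
    rw [Matrix.conjTranspose_mul, Matrix.mul_assoc, ← Matrix.mul_assoc V', h1,
      Matrix.diagonal_conjTranspose, Matrix.diagonal_mul_diagonal, Matrix.diagonal_mul_diagonal,
      ← Matrix.diagonal_one]
    congr 1
    ext k
    have h2 : ((s k : ℝ) : ℂ) = (√(s k) : ℂ) * (√(s k) : ℂ) := by
      exact_mod_cast (Real.mul_self_sqrt (hs k)).symm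
    simp only [Pi.star_apply, star_inv₀, Complex.star_def, Complex.conj_ofReal]
    rw [h2]
    field_simp [hpos k]
  · have h1 : Matrix.diagonal (fun k : {i // s i ≠ 0} => (√(s k) : ℂ)) * E = 1 := by
      rw [Matrix.diagonal_mul_diagonal, ← Matrix.diagonal_one]
      exact congrArg _ (funext fun k => mul_inv_cancel₀ (hpos k))
    rw [Matrix.mul_assoc, ← Matrix.mul_assoc _ E, h1, Matrix.one_mul]
    conv_lhs => rw [hMV]
    ext i j
    simp only [Matrix.mul_apply, Matrix.submatrix_apply, id, W, V']
    rw [← Finset.sum_filter_of_ne (p := fun k => s k ≠ 0) fun k _ hk hs' =>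
      hk (by rw [hV0 k hs', mul_zero])]
    exact Finset.sum_subtype _ (by simp) fun k => U i k * V k j

/-- Bathtub principle: after subtracting the threshold `s k`, full weight on the indices below `k`
and none elsewhere is optimal. -/
theorem sum_mul_le_sum_of_antitone {a : ℕ} (s : ℕ → ℝ) (hs : Antitone s) (hs0 : ∀ k, 0 ≤ s k)
    (w : Fin a → ℝ) (hw0 : ∀ i, 0 ≤ w i) (hw1 : ∀ i, w i ≤ 1) (k : ℕ)
    (hk : ∑ i, w i ≤ k) :
    ∑ i : Fin a, s i * w i ≤ ∑ i ∈ Finset.range k, s i := by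
  rcases le_total a k with hak | hka
  · calc ∑ i : Fin a, s i * w i ≤ ∑ i : Fin a, s i :=
          Finset.sum_le_sum fun i _ => mul_le_of_le_one_right (hs0 _) (hw1 i)
      _ = ∑ i ∈ Finset.range a, s i := Fin.sum_univ_eq_sum_range s a
      _ ≤ _ := Finset.sum_le_sum_of_subset_of_nonneg (Finset.range_subset_range.mpr hak)
          fun _ _ _ => hs0 _
  · have h1 : ∀ i : Fin a, (s i - s k) * w i ≤ if (i : ℕ) < k then s i - s k else 0 := by
      intro i
      split_ifs with h
      · exact mul_le_of_le_one_right (sub_nonneg.mpr (hs h.le)) (hw1 i)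
      · exact mul_nonpos_of_nonpos_of_nonneg (sub_nonpos.mpr (hs (not_lt.mp h))) (hw0 i)
    have h2 := Finset.sum_le_sum fun i (_ : i ∈ Finset.univ) => h1 i
    rw [Fin.sum_univ_eq_sum_range (fun i => if i < k then s i - s k else 0),
      ← Finset.sum_filter] at h2
    have h3 : (Finset.range a).filter (· < k) = Finset.range k := by
      ext i; simp; omega
    rw [h3, Finset.sum_sub_distrib] at h2
    simp only [sub_mul, Finset.sum_sub_distrib, ← Finset.mul_sum, Finset.sum_const,
      Finset.card_range, nsmul_eq_mul] at h2
    linarith [mul_le_mul_of_nonneg_left hk (hs0 k)]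

open scoped ComplexOrder in
/-- The column space of a matrix has an orthonormal basis. -/
theorem exists_isometry_of_rank (Y : Matrix m n ℂ) :
    ∃ W : Matrix m (Fin Y.rank) ℂ, Wᴴ * W = 1 ∧ W * (Wᴴ * Y) = Y := by
  classical
  have hA := Matrix.isHermitian_mul_conjTranspose_self Y
  have hU := Matrix.mem_unitaryGroup_iff'.mp hA.eigenvectorUnitary.2
  obtain ⟨W, Z, hW, hZ, hY⟩ := hasSchmidtForm_of_diagonalization Y hA.eigenvectorUnitary
    hA.eigenvalues (Matrix.eigenvalues_self_mul_conjTranspose_nonneg Y) hU (by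
      conv_lhs => rw [hA.spectral_theorem]
      rfl)
  have hr : Fintype.card {i // hA.eigenvalues i ≠ 0} = Y.rank := by
    rw [← hA.rank_eq_card_non_zero_eigs, Matrix.rank_self_mul_conjTranspose]
  let e := (Fintype.equivFinOfCardEq hr).symm
  refine ⟨W.submatrix id e, ?_, ?_⟩
  · rw [Matrix.conjTranspose_submatrix, ← Matrix.submatrix_mul _ _ _ _ _ Function.bijective_id, hW]
    exact Matrix.submatrix_one _ e.injective
  · rw [Matrix.conjTranspose_submatrix, ← Matrix.mul_assoc,
      ← Matrix.submatrix_mul _ _ _ _ _ e.bijective, Matrix.submatrix_id_id]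
    have h1 := congrArg (W * Wᴴ * ·) hY
    simp only [Matrix.mul_assoc] at h1 hY ⊢
    rw [← Matrix.mul_assoc Wᴴ W, hW, Matrix.one_mul, ← hY] at h1
    exact h1

end SingularValues

/-! ### Schmidt coefficients, low-rank approximation and monotonicity -/

namespace PureState

variable (φ : PureState)

theorem schmidt_of_lt {k : ℕ} (h : k < φ.dimA) : φ.schmidt k =
    (Matrix.isHermitian_mul_conjTranspose_self φ.amp).eigenvalues₀ ⟨k, by simpa using h⟩ :=
  dif_pos (by simpa using h)

theorem schmidt_of_le {k : ℕ} (h : φ.dimA ≤ k) : φ.schmidt k = 0 :=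
  dif_neg (by simpa using h)

/-- `schmidt` uses the sorted `eigenvalues₀`, whereas the spectral theorem uses `eigenvalues`,
indexed through an arbitrary enumeration. -/
theorem exists_perm_eigenvalues : ∃ f : Fin φ.dimA ≃ Fin φ.dimA, ∀ i,
    (Matrix.isHermitian_mul_conjTranspose_self φ.amp).eigenvalues (f i) = φ.schmidt i := by
  refine ⟨(finCongr (Fintype.card_fin _).symm).trans (Fintype.equivOfCardEq (Fintype.card_fin _)),
    fun i => ?_⟩
  rw [schmidt_of_lt _ i.2, Matrix.IsHermitian.eigenvalues, Equiv.trans_apply,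
    Equiv.symm_apply_apply]
  rfl

open scoped ComplexOrder in
theorem schmidt_nonneg (k : ℕ) : 0 ≤ φ.schmidt k := by
  rcases lt_or_ge k φ.dimA with h | h
  · obtain ⟨f, hf⟩ := φ.exists_perm_eigenvalues
    rw [show k = ((⟨k, h⟩ : Fin φ.dimA) : ℕ) from rfl, ← hf]
    exact Matrix.eigenvalues_self_mul_conjTranspose_nonneg _ _
  · rw [schmidt_of_le _ h]

theorem schmidt_antitone : Antitone φ.schmidt := by
  intro j k hjk
  rcases lt_or_ge k φ.dimA with h | h
  · rw [schmidt_of_lt _ h, schmidt_of_lt _ (hjk.trans_lt h)]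
    exact Matrix.IsHermitian.eigenvalues₀_antitone _ hjk
  · rw [schmidt_of_le _ h]
    exact φ.schmidt_nonneg j

theorem exists_diagonalization : ∃ U : Matrix (Fin φ.dimA) (Fin φ.dimA) ℂ, Uᴴ * U = 1 ∧
    φ.amp * φ.ampᴴ = U * Matrix.diagonal (fun i : Fin φ.dimA => (φ.schmidt i : ℂ)) * Uᴴ := by
  obtain ⟨f, hf⟩ := φ.exists_perm_eigenvalues
  have hA := Matrix.isHermitian_mul_conjTranspose_self φ.amp
  have hU := Matrix.mem_unitaryGroup_iff'.mp hA.eigenvectorUnitary.2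
  refine ⟨(hA.eigenvectorUnitary : Matrix _ _ ℂ).submatrix id f, ?_, ?_⟩
  · rw [Matrix.conjTranspose_submatrix, ← Matrix.submatrix_mul _ _ _ _ _ Function.bijective_id]
    erw [hU]
    exact Matrix.submatrix_one _ f.injective
  · have : Matrix.diagonal (fun i : Fin φ.dimA => (φ.schmidt i : ℂ)) =
        (Matrix.diagonal (fun i => (hA.eigenvalues i : ℂ))).submatrix f f := by
      rw [Matrix.submatrix_diagonal _ _ f.injective]
      congr 1
      ext i
      simp [hf]
    rw [this, Matrix.conjTranspose_submatrix, ← Matrix.submatrix_mul _ _ _ _ _ f.bijective,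
      ← Matrix.submatrix_mul _ _ _ _ _ f.bijective, Matrix.submatrix_id_id]
    conv_lhs => rw [hA.spectral_theorem]
    rfl

theorem sum_schmidt : ∑ i : Fin φ.dimA, φ.schmidt i = 1 := by
  obtain ⟨U, hU, h⟩ := φ.exists_diagonalization
  have h1 := φ.frobSq_amp
  rw [frobSq_eq_trace_re, h, Matrix.trace_mul_comm, ← Matrix.mul_assoc, hU, Matrix.one_mul] at h1
  simpa [Matrix.trace] using h1

theorem hasSchmidtForm :
    HasSchmidtForm φ.amp (fun k : {i : Fin φ.dimA // φ.schmidt i ≠ 0} => φ.schmidt k) := by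
  obtain ⟨U, hU, h⟩ := φ.exists_diagonalization
  exact hasSchmidtForm_of_diagonalization _ U (fun i : Fin φ.dimA => φ.schmidt i)
    (fun i => φ.schmidt_nonneg i) hU h

/-- Approximation by matrices of rank at most `k`, existence. -/
theorem exists_rank_le_frobSq_sub_eq (k : ℕ) :
    ∃ X : Matrix (Fin φ.dimA) (Fin φ.dimB) ℂ, X.rank ≤ k ∧
      frobSq (φ.amp - X) = 1 - ∑ i ∈ Finset.range k, φ.schmidt i := by
  obtain ⟨U, hU, h⟩ := φ.exists_diagonalization
  have hU' : U * Uᴴ = 1 := mul_eq_one_comm.mp hU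
  let D : Matrix (Fin φ.dimA) (Fin φ.dimA) ℂ :=
    Matrix.diagonal fun i => if (i : ℕ) < k then 1 else 0
  let D' : Matrix (Fin φ.dimA) (Fin φ.dimA) ℂ :=
    Matrix.diagonal fun i => if (i : ℕ) < k then 0 else 1
  have hD : D + D' = 1 := by
    rw [Matrix.diagonal_add, ← Matrix.diagonal_one]
    congr 1
    ext i
    split_ifs <;> simp
  -- Project onto the `k` leading eigenvectors; the discarded rows of `Uᴴ * φ.amp` have squared
  -- norms `schmidt i` with `i ≥ k`.
  refine ⟨U * (D * (Uᴴ * φ.amp)), ?_, ?_⟩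
  · refine (Matrix.rank_mul_le_right _ _).trans ((Matrix.rank_mul_le_left _ _).trans ?_)
    rw [Matrix.rank_diagonal, Fintype.card_subtype]
    calc _ ≤ (Finset.range k).card := Finset.card_le_card_of_injOn (fun i : Fin φ.dimA => (i : ℕ))
          (fun i hi => by simpa using hi) (fun _ _ _ _ hij => Fin.ext hij)
      _ = k := Finset.card_range k
  · have h1 : φ.amp - U * (D * (Uᴴ * φ.amp)) = U * (D' * (Uᴴ * φ.amp)) := by
      rw [sub_eq_iff_eq_add', ← Matrix.mul_add, ← Matrix.add_mul, hD, Matrix.one_mul,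
        ← Matrix.mul_assoc, hU', Matrix.one_mul]
    have h2 : (Uᴴ * φ.amp) * (Uᴴ * φ.amp)ᴴ =
        Matrix.diagonal (fun i : Fin φ.dimA => (φ.schmidt i : ℂ)) := by
      rw [Matrix.conjTranspose_mul, Matrix.conjTranspose_conjTranspose, Matrix.mul_assoc,
        ← Matrix.mul_assoc φ.amp, h]
      simp only [Matrix.mul_assoc, hU, Matrix.mul_one]
      rw [← Matrix.mul_assoc, hU, Matrix.one_mul]
    rw [h1, frobSq_mul_of_isometry _ hU, frobSq_eq_trace_re, Matrix.conjTranspose_mul,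
      Matrix.mul_assoc, ← Matrix.mul_assoc (Uᴴ * φ.amp), h2, Matrix.diagonal_conjTranspose,
      Matrix.diagonal_mul_diagonal, Matrix.diagonal_mul_diagonal, Matrix.trace_diagonal,
      Complex.re_sum, eq_sub_iff_add_eq, ← φ.sum_schmidt]
    have h3 : ∑ i ∈ Finset.range k, φ.schmidt i =
        ∑ i : Fin φ.dimA, if (i : ℕ) < k then φ.schmidt i else 0 := by
      rw [Fin.sum_univ_eq_sum_range (fun i => if i < k then φ.schmidt i else 0),
        ← Finset.sum_filter]
      symm
      apply Finset.sum_subset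
      · intro i; simp
      · intro i hi hi'
        apply φ.schmidt_of_le
        simpa [Finset.mem_range.mp hi] using hi'
    rw [h3, ← Finset.sum_add_distrib]
    refine Finset.sum_congr rfl fun i _ => ?_
    split_ifs <;> simp [*]

/-- Approximation by matrices of rank at most `k`, lower bound. -/
theorem le_frobSq_sub_of_rank_le {k : ℕ} (Y : Matrix (Fin φ.dimA) (Fin φ.dimB) ℂ)
    (hY : Y.rank ≤ k) : 1 - ∑ i ∈ Finset.range k, φ.schmidt i ≤ frobSq (φ.amp - Y) := by
  obtain ⟨W, hW, hWY⟩ := exists_isometry_of_rank Y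
  obtain ⟨U, hU, h⟩ := φ.exists_diagonalization
  have hU' : U * Uᴴ = 1 := mul_eq_one_comm.mp hU
  -- The projection onto the complement of the column space of `Y` kills `Y`, so the distance is at
  -- least the part of `φ.amp` outside that space.
  have h1 : (1 - W * Wᴴ) * (φ.amp - Y) = (1 - W * Wᴴ) * φ.amp := by
    rw [Matrix.mul_sub, Matrix.sub_mul _ _ Y, Matrix.mul_assoc W, hWY]
    simp
  have h2 := frobSq_add_frobSq_of_isometry W hW φ.amp
  have h3 := frobSq_add_frobSq_of_isometry W hW (φ.amp - Y)
  rw [h1] at h3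
  rw [φ.frobSq_amp] at h2
  have h4 := frobSq_nonneg (Wᴴ * (φ.amp - Y))
  obtain ⟨T, hT⟩ : ∃ T, T = Wᴴ * U := ⟨_, rfl⟩
  have hTT : T * Tᴴ = 1 := by
    rw [hT, Matrix.conjTranspose_mul, Matrix.conjTranspose_conjTranspose, Matrix.mul_assoc,
      ← Matrix.mul_assoc U, hU', Matrix.one_mul, hW]
  let w : Fin φ.dimA → ℝ := fun i => ∑ l, ‖T l i‖ ^ 2
  have h5 : frobSq (Wᴴ * φ.amp) = ∑ i : Fin φ.dimA, φ.schmidt i * w i := by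
    have : (Wᴴ * φ.amp) * (Wᴴ * φ.amp)ᴴ =
        T * Matrix.diagonal (fun i : Fin φ.dimA => (φ.schmidt i : ℂ)) * Tᴴ := by
      rw [Matrix.conjTranspose_mul, Matrix.conjTranspose_conjTranspose, Matrix.mul_assoc,
        ← Matrix.mul_assoc φ.amp, h, hT, Matrix.conjTranspose_mul,
        Matrix.conjTranspose_conjTranspose]
      simp only [Matrix.mul_assoc]
    rw [frobSq_eq_trace_re, this]
    simp only [Matrix.trace, Matrix.diag_apply, Matrix.mul_apply (N := Tᴴ), Matrix.mul_diagonal,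
      Matrix.conjTranspose_apply, w, Finset.mul_sum, Complex.re_sum]
    rw [Finset.sum_comm]
    refine Finset.sum_congr rfl fun i _ => Finset.sum_congr rfl fun l _ => ?_
    rw [mul_right_comm, Complex.star_def, Complex.mul_conj', mul_comm]
    norm_cast
  have hw : ∑ i, w i = Y.rank := by
    have := congrArg Complex.re (congrArg Matrix.trace hTT)
    rw [← frobSq_eq_trace_re, Matrix.trace_one, Fintype.card_fin, frobSq, Finset.sum_comm] at this
    simpa using this
  -- `Tᴴ * T` is a projection with diagonal `w`, so `w i ^ 2 ≤ w i`.
  have hw1 : ∀ i, w i ≤ 1 := by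
    intro i
    have hQ : (Tᴴ * T) * (Tᴴ * T)ᴴ = Tᴴ * T := by
      rw [Matrix.conjTranspose_mul Tᴴ, Matrix.conjTranspose_conjTranspose, Matrix.mul_assoc,
        ← Matrix.mul_assoc T, hTT, Matrix.one_mul]
    have hd : (Tᴴ * T) i i = (w i : ℂ) := by
      simp [Matrix.mul_apply, w, Complex.conj_mul']
    have h6 : w i = ∑ j, ‖(Tᴴ * T) i j‖ ^ 2 := by
      have := congrFun (congrFun hQ i) i
      rw [hd, Matrix.mul_apply] at this
      simp only [Matrix.conjTranspose_apply, Complex.star_def, Complex.mul_conj'] at this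
      exact_mod_cast this.symm
    have h7 : ‖(Tᴴ * T) i i‖ ^ 2 ≤ w i := by
      rw [h6]
      exact Finset.single_le_sum (f := fun j => ‖(Tᴴ * T) i j‖ ^ 2) (fun _ _ => by positivity)
        (Finset.mem_univ i)
    rw [hd, Complex.norm_real, Real.norm_eq_abs, sq_abs] at h7
    nlinarith
  have h8 := sum_mul_le_sum_of_antitone φ.schmidt φ.schmidt_antitone φ.schmidt_nonneg
    w (fun i => by positivity) hw1 k (by rw [hw]; exact_mod_cast hY)
  linarith

variable {φ}

/-- The sums of the largest Schmidt coefficients do not decrease under deterministic LOCC. -/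
theorem ConvertsTo.sum_schmidt_le {ψ : PureState} (h : φ.ConvertsTo ψ) (k : ℕ) :
    ∑ i ∈ Finset.range k, φ.schmidt i ≤ ∑ i ∈ Finset.range k, ψ.schmidt i := by
  obtain ⟨ι, _, A, B, c, hc, hc1, hf⟩ := h.exists_local
  obtain ⟨X, hX, hXf⟩ := φ.exists_rank_le_frobSq_sub_eq k
  -- For `c l ≠ 0`, the branch sends `φ.amp - X` to `c l` times the difference of `ψ.amp` and a
  -- matrix of rank at most `k`.
  have h1 : ∀ l, ‖c l‖ ^ 2 * (1 - ∑ i ∈ Finset.range k, ψ.schmidt i) ≤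
      frobSq (A l * (φ.amp - X) * B l) := by
    intro l
    by_cases hl : c l = 0
    · simpa [hl] using frobSq_nonneg _
    · have : A l * (φ.amp - X) * B l = c l • (ψ.amp - ((c l)⁻¹ • A l) * X * B l) := by
        rw [Matrix.mul_sub, Matrix.sub_mul, hc, smul_sub, Matrix.smul_mul, Matrix.smul_mul,
          smul_smul, mul_inv_cancel₀ hl, one_smul]
      rw [this, frobSq_smul]
      refine mul_le_mul_of_nonneg_left (ψ.le_frobSq_sub_of_rank_le _ ?_) (by positivity)
      exact ((Matrix.rank_mul_le_left _ _).trans (Matrix.rank_mul_le_right _ _)).trans hX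
  have h2 := Finset.sum_le_sum fun l (_ : l ∈ Finset.univ) => h1 l
  rw [hf, hXf, ← Finset.sum_mul, hc1] at h2
  linarith

theorem equivalent_of_convertsTo {ψ : PureState} (h₁ : φ.ConvertsTo ψ) (h₂ : ψ.ConvertsTo φ) :
    φ.Equivalent ψ := by
  have h : ∀ k, ∑ i ∈ Finset.range k, φ.schmidt i = ∑ i ∈ Finset.range k, ψ.schmidt i :=
    fun k => le_antisymm (h₁.sum_schmidt_le k) (h₂.sum_schmidt_le k)
  ext k
  have h3 := h (k + 1)
  rw [Finset.sum_range_succ, Finset.sum_range_succ, h k] at h3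
  linarith

end PureState

/-! ### Construction of protocols -/

/-- Some protocol sends the unnormalized state `M` to `t` times the unnormalized state `N`. -/
def Reaches {a b a' b' : ℕ} (M : Matrix (Fin a) (Fin b) ℂ) (N : Matrix (Fin a') (Fin b') ℂ)
    (t : ℝ) : Prop :=
  ∃ P : LOCC a' b' a b, P.apply (pureDensity M) = (t : ℂ) • pureDensity N

namespace Reaches

variable {a b a' b' c : ℕ} {M : Matrix (Fin a) (Fin b) ℂ} {N : Matrix (Fin a') (Fin b') ℂ}

theorem refl (M : Matrix (Fin a) (Fin b) ℂ) : Reaches M M 1 := ⟨.done, by simp [LOCC.apply]⟩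

theorem of_smul {z : ℂ} (h : Reaches M (z • N) 1) : Reaches M N (‖z‖ ^ 2) := by
  obtain ⟨P, hP⟩ := h
  exact ⟨P, by rw [hP, pureDensity_smul, Complex.ofReal_one, one_smul]⟩

/-- A branch of probability zero still needs a continuation with the right output dimensions; `h`
supplies one. -/
theorem zero {t : ℝ} (h : Reaches M N t) : Reaches (0 : Matrix (Fin a) (Fin b) ℂ) N 0 := by
  obtain ⟨P, hP⟩ := h
  exact ⟨P, by rw [pureDensity_zero, P.apply_zero, Complex.ofReal_zero, zero_smul]⟩

theorem alice {τ : Type*} [Fintype τ] (K : τ → Matrix (Fin c) (Fin a) ℂ)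
    (hK : ∑ i, (K i)ᴴ * K i = 1) {t : τ → ℝ} (h : ∀ i, Reaches (K i * M) N (t i)) :
    Reaches M N (∑ i, t i) := by
  choose P hP using h
  let e := (Fintype.equivFin τ).symm
  refine ⟨.alice _ (fun _ => c) (fun i => K (e i)) ?_ (fun i => P (e i)), ?_⟩
  · rw [← hK, ← e.sum_comp]
  · simp only [LOCC.apply, alice_pureDensity, hP]
    rw [e.sum_comp fun i => (t i : ℂ) • pureDensity N, ← Finset.sum_smul, Complex.ofReal_sum]

/-- Bob's Kraus operators act on amplitudes from the right as transposes, which turns completeness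
into `∑ R Rᴴ = 1`. -/
theorem bob {τ : Type*} [Fintype τ] (R : τ → Matrix (Fin b) (Fin c) ℂ)
    (hR : ∑ i, R i * (R i)ᴴ = 1) {t : τ → ℝ} (h : ∀ i, Reaches (M * R i) N (t i)) :
    Reaches M N (∑ i, t i) := by
  choose P hP using h
  let e := (Fintype.equivFin τ).symm
  refine ⟨.bob _ (fun _ => c) (fun i => (R (e i))ᵀ) ?_ (fun i => P (e i)), ?_⟩
  · have h1 : ∀ i, ((R i)ᵀ)ᴴ * (R i)ᵀ = (R i * (R i)ᴴ)ᵀ := fun i => by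
      rw [Matrix.transpose_mul]; rfl
    simp_rw [h1]
    rw [e.sum_comp fun i => (R i * (R i)ᴴ)ᵀ, ← Matrix.transpose_sum, hR, Matrix.transpose_one]
  · simp only [LOCC.apply, bob_pureDensity, Matrix.transpose_transpose, hP]
    rw [e.sum_comp fun i => (t i : ℂ) • pureDensity N, ← Finset.sum_smul, Complex.ofReal_sum]

/-- An orthogonal projection is completed to a measurement. -/
theorem exists_kraus_completion {n : ℕ} (hc : 0 < c) (Q : Matrix (Fin n) (Fin n) ℂ)
    (hQ : Qᴴ = Q) (hQQ : Q * Q = Q) :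
    ∃ X : Fin n → Matrix (Fin c) (Fin n) ℂ,
      ∑ j, (X j * (1 - Q))ᴴ * (X j * (1 - Q)) = 1 - Q := by
  have h1 : (1 - Q)ᴴ * (1 - Q) = 1 - Q := by
    simp [Matrix.conjTranspose_sub, hQ, mul_sub, sub_mul, hQQ]
  -- Outcome `j` sends the `j`-th basis vector to a fixed one, so any positive output dimension will
  -- do.
  refine ⟨fun j => Matrix.single ⟨0, hc⟩ j 1, ?_⟩
  have h2 : ∑ j : Fin n, (Matrix.single (⟨0, hc⟩ : Fin c) j (1 : ℂ))ᴴ *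
      Matrix.single (⟨0, hc⟩ : Fin c) j (1 : ℂ) = 1 := by
    simp only [Matrix.conjTranspose_single, star_one, Matrix.single_mul_single_same, one_mul]
    ext i k
    simp [Matrix.sum_apply, Matrix.single_apply, Matrix.one_apply, ite_and]
  simp_rw [Matrix.conjTranspose_mul, Matrix.mul_assoc (1 - Q)ᴴ]
  rw [← Matrix.mul_sum]
  simp_rw [← Matrix.mul_assoc _ _ (1 - Q)]
  rw [← Matrix.sum_mul, h2, Matrix.one_mul, h1]

/-- Completeness on the range of `Q` suffices, because the outcomes that complete the measurement
annihilate `M = Q * M`. -/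
theorem alice_of_projection (hc : 0 < c) {τ : Type*} [Fintype τ] [Nonempty τ]
    (K : τ → Matrix (Fin c) (Fin a) ℂ) (Q : Matrix (Fin a) (Fin a) ℂ) (hQ : Qᴴ = Q)
    (hQQ : Q * Q = Q) (hQM : Q * M = M) (hK : ∑ i, (K i)ᴴ * K i = Q) {t : τ → ℝ}
    (h : ∀ i, Reaches (K i * M) N (t i)) : Reaches M N (∑ i, t i) := by
  obtain ⟨X, hX⟩ := exists_kraus_completion hc Q hQ hQQ
  have key : Reaches M N (∑ i, Sum.elim t (fun _ : Fin a => 0) i) := by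
    refine alice (Sum.elim K fun j => X j * (1 - Q)) ?_ ?_
    · rw [Fintype.sum_sum_type]
      simp only [Sum.elim_inl, Sum.elim_inr]
      rw [hK, hX, add_sub_cancel]
    · rintro (i | j)
      · exact h i
      · have : X j * (1 - Q) * M = 0 := by
          rw [Matrix.mul_assoc, Matrix.sub_mul, hQM, Matrix.one_mul, sub_self, Matrix.mul_zero]
        simp only [Sum.elim_inr, this]
        exact (h (Classical.arbitrary τ)).zero
  simpa [Fintype.sum_sum_type] using key

/-- Bob's main Kraus operator carries the row space of `Y` isometrically to that of `Z`; the
completing outcomes never occur. -/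
theorem bob_of_coisometry (hc : 0 < b') {κ : Type*} [Fintype κ] [DecidableEq κ]
    (A : Matrix (Fin a) κ ℂ) (Y : Matrix κ (Fin b) ℂ) (Z : Matrix κ (Fin b') ℂ)
    (hY : Y * Yᴴ = 1) (hZ : Z * Zᴴ = 1) : Reaches (A * Y) (A * Z) 1 := by
  have hQQ : Yᴴ * Y * (Yᴴ * Y) = Yᴴ * Y := by
    rw [Matrix.mul_assoc, ← Matrix.mul_assoc Y, hY, Matrix.one_mul]
  have hQ : (Yᴴ * Y)ᴴ = Yᴴ * Y := by
    rw [Matrix.conjTranspose_mul, Matrix.conjTranspose_conjTranspose]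
  obtain ⟨X, hX⟩ := exists_kraus_completion hc (Yᴴ * Y) hQ hQQ
  have h0 : A * Y * (Yᴴ * Z) = A * Z := by
    rw [Matrix.mul_assoc, ← Matrix.mul_assoc Y, hY, Matrix.one_mul]
  have key : Reaches (A * Y) (A * Z)
      (∑ i, Sum.elim (fun _ : Unit => (1 : ℝ)) (fun _ : Fin b => 0) i) := by
    refine bob (Sum.elim (fun _ => Yᴴ * Z) fun j => (X j * (1 - Yᴴ * Y))ᴴ) ?_ ?_
    · rw [Fintype.sum_sum_type]
      simp only [Sum.elim_inl, Sum.elim_inr, Matrix.conjTranspose_conjTranspose]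
      rw [hX, Fintype.sum_unique, Matrix.conjTranspose_mul, Matrix.conjTranspose_conjTranspose,
        Matrix.mul_assoc, ← Matrix.mul_assoc Z, hZ, Matrix.one_mul, add_sub_cancel]
    · rintro (i | j)
      · simp only [Sum.elim_inl, h0]
        exact refl _
      · have h1 : Y * (1 - Yᴴ * Y) = 0 := by
          rw [Matrix.mul_sub, ← Matrix.mul_assoc, hY, Matrix.one_mul, Matrix.mul_one, sub_self]
        have h2 : A * Y * (X j * (1 - Yᴴ * Y))ᴴ = 0 := by
          rw [Matrix.conjTranspose_mul, Matrix.conjTranspose_sub, hQ, Matrix.conjTranspose_one,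
            Matrix.mul_assoc, ← Matrix.mul_assoc Y, h1, Matrix.zero_mul, Matrix.mul_zero]
        simp only [Sum.elim_inr, h2]
        exact (refl (A * Z)).zero
  simpa [Fintype.sum_sum_type] using key

/-- If the Schmidt coefficients `s` are a mixture of rearrangements of the Schmidt coefficients
`μ`, then a state with coefficients `s` can be transformed into one with coefficients `μ`. -/
theorem of_mixture (ha' : 0 < a') (hb' : 0 < b') {ι κ τ : Type*} [Fintype ι] [DecidableEq ι]
    [Fintype κ] [DecidableEq κ] [Fintype τ] {s : ι → ℝ} {μ : κ → ℝ}
    (hM : HasSchmidtForm M s) (hN : HasSchmidtForm N μ) (hs : ∀ i, 0 < s i) (hμ : ∀ k, 0 ≤ μ k)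
    (t : τ → ℝ) (ht : ∀ p, 0 ≤ t p) (ht1 : ∑ p, t p = 1) (σ : τ → κ → ι)
    (hσ : ∀ p, Function.Injective (σ p))
    (hst : ∀ i, ∑ p, t p * ∑ k, (if σ p k = i then μ k else 0) = s i) : Reaches M N 1 := by
  obtain ⟨W, Z, hW, hZ, rfl⟩ := hM
  obtain ⟨W', Z', hW', hZ', rfl⟩ := hN
  have hτ : Nonempty τ := by
    by_contra h
    rw [not_nonempty_iff] at h
    simp at ht1
  let D : Matrix κ κ ℂ := Matrix.diagonal fun k => (√(μ k) : ℂ)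
  let F : Matrix ι ι ℂ := Matrix.diagonal fun i => (√(s i) : ℂ)
  -- Alice's outcome `p` moves index `σ p k` to `k` and rescales its coefficient from `s` to `t p *
  -- μ k`; completeness of these operators is exactly `hst`.
  let C : τ → Matrix κ ι ℂ := fun p =>
    Matrix.of fun k i => if σ p k = i then ((√(t p) * √(μ k) / √(s i) : ℝ) : ℂ) else 0
  have hCF : ∀ p, C p * F * Z = ((√(t p) : ℝ) : ℂ) • (D * Z.submatrix (σ p) id) := by
    intro p
    ext k j
    simp only [C, F, D, Matrix.mul_apply (N := Z), Matrix.mul_diagonal, Matrix.of_apply,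
      Matrix.smul_apply, Matrix.diagonal_mul, Matrix.submatrix_apply, id, smul_eq_mul, ite_mul,
      zero_mul, Finset.sum_ite_eq, Finset.mem_univ, if_true]
    have : (√(s (σ p k)) : ℂ) ≠ 0 := by exact_mod_cast (Real.sqrt_pos.mpr (hs _)).ne'
    push_cast
    field_simp
  have hCC : ∑ p, (C p)ᴴ * C p = 1 := by
    ext i j
    simp only [Matrix.sum_apply, Matrix.mul_apply, Matrix.conjTranspose_apply, C, Matrix.of_apply]
    have h1 : ∀ p k, star (if σ p k = i then ((√(t p) * √(μ k) / √(s i) : ℝ) : ℂ) else 0) *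
        (if σ p k = j then ((√(t p) * √(μ k) / √(s j) : ℝ) : ℂ) else 0) =
        if i = j then ((t p * (if σ p k = i then μ k else 0) / s i : ℝ) : ℂ) else 0 := by
      intro p k
      by_cases hi : σ p k = i
      · by_cases hj : i = j
        · subst hj
          simp only [hi, if_true, Complex.star_def, Complex.conj_ofReal]
          rw [← Complex.ofReal_mul]
          congr 1
          rw [div_mul_div_comm, Real.mul_self_sqrt (hs i).le, mul_mul_mul_comm,
            Real.mul_self_sqrt (ht p), Real.mul_self_sqrt (hμ k)]
        · simp [hi, hj]
      · simp [hi]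
    simp_rw [h1]
    by_cases hij : i = j
    · subst hij
      simp only [if_true, Matrix.one_apply_eq, ← Complex.ofReal_sum]
      simp_rw [← Finset.sum_div, ← Finset.mul_sum]
      rw [hst, div_self (hs i).ne', Complex.ofReal_one]
    · simp [hij]
  rw [← ht1]
  refine alice_of_projection ha' (fun p => W' * C p * Wᴴ) (W * Wᴴ) ?_ ?_ ?_ ?_ fun p => ?_
  · rw [Matrix.conjTranspose_mul, Matrix.conjTranspose_conjTranspose]
  · rw [Matrix.mul_assoc, ← Matrix.mul_assoc Wᴴ, hW, Matrix.one_mul]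
  · simp only [Matrix.mul_assoc]
    rw [← Matrix.mul_assoc Wᴴ W, hW, Matrix.one_mul]
  · have : ∀ p, (W' * C p * Wᴴ)ᴴ * (W' * C p * Wᴴ) = W * ((C p)ᴴ * C p) * Wᴴ := by
      intro p
      simp only [Matrix.conjTranspose_mul, Matrix.conjTranspose_conjTranspose, Matrix.mul_assoc]
      rw [← Matrix.mul_assoc W'ᴴ, hW', Matrix.one_mul]
    simp_rw [this]
    rw [← Matrix.sum_mul, ← Matrix.mul_sum, hCC, Matrix.mul_one]
  · have h1 : W' * C p * Wᴴ * (W * F * Z) =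
        (((√(t p) : ℝ) : ℂ) • (W' * D)) * Z.submatrix (σ p) id := by
      calc _ = W' * (C p * ((Wᴴ * W) * F * Z)) := by simp only [Matrix.mul_assoc]
        _ = W' * (C p * F * Z) := by rw [hW, Matrix.one_mul]; simp only [Matrix.mul_assoc]
        _ = _ := by rw [hCF, Matrix.mul_smul, Matrix.smul_mul, Matrix.mul_assoc]
    -- Since `σ p` is injective, the selected rows of `Z` still form a coisometry, which Bob turns
    -- into `Z'`.
    have h2 : Z.submatrix (σ p) id * (Z.submatrix (σ p) id)ᴴ = 1 := by
      rw [Matrix.conjTranspose_submatrix, ← Matrix.submatrix_mul _ _ _ _ _ Function.bijective_id,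
        hZ]
      exact Matrix.submatrix_one _ (hσ p)
    have h3 := bob_of_coisometry hb' (((√(t p) : ℝ) : ℂ) • (W' * D)) _ Z' h2 hZ'
    rw [← h1, Matrix.smul_mul] at h3
    have h4 := h3.of_smul
    rwa [Complex.norm_real, Real.norm_eq_abs, sq_abs, Real.sq_sqrt (ht p)] at h4

end Reaches

/-! ### Conversion to equivalent states and to two-level states -/

/-- A probability vector with entries at most `1 / 2` consists of the row sums of a symmetric
nonnegative matrix with zero diagonal. -/
theorem exists_symm_offDiag_of_le_half {ι : Type*} [Fintype ι] [DecidableEq ι] (s : ι → ℝ)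
    (hs : ∀ i, 0 ≤ s i) (hs1 : ∑ i, s i = 1) (hs2 : ∀ i, s i ≤ 1 / 2) :
    ∃ w : ι → ι → ℝ, (∀ i j, 0 ≤ w i j) ∧ (∀ i j, w i j = w j i) ∧ (∀ i, w i i = 0) ∧
      ∀ i, ∑ j, w i j = s i := by
  -- Reduction to three entries: a largest set `A` of weight at most `1 / 2`, one further index
  -- `i₀`, and the rest, whose weight is below `1 / 2` by maximality of `A`.
  obtain ⟨f, hf⟩ : ∃ f : ι → Fin 3, ∀ a, ∑ i with f i = a, s i ≤ 1 / 2 := by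
    obtain ⟨A, hA, hmax⟩ := Finset.exists_max_image
      (Finset.univ.filter fun A : Finset ι => ∑ i ∈ A, s i ≤ 1 / 2) Finset.card
      ⟨∅, by simp⟩
    simp only [Finset.mem_filter, Finset.mem_univ, true_and] at hA hmax
    obtain ⟨i₀, hi₀⟩ : ∃ i, i ∉ A := by
      by_contra! h
      rw [Finset.eq_univ_of_forall h, hs1] at hA
      norm_num at hA
    have h1 : 1 / 2 < ∑ i ∈ insert i₀ A, s i := by
      by_contra! h
      have := hmax _ h
      rw [Finset.card_insert_of_notMem hi₀] at this
      omega
    refine ⟨fun i => if i ∈ A then 0 else if i = i₀ then 1 else 2, fun a => ?_⟩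
    fin_cases a
    · convert hA using 2
      ext i
      simp only [Finset.mem_filter, Finset.mem_univ, true_and]
      split_ifs <;> simp [*]
    · have : (Finset.univ.filter fun i => (if i ∈ A then (0 : Fin 3) else
          if i = i₀ then 1 else 2) = 1) = {i₀} := by
        ext i
        simp only [Finset.mem_filter, Finset.mem_univ, true_and, Finset.mem_singleton]
        split_ifs with h h'
        · simpa using fun h' : i = i₀ => hi₀ (h' ▸ h)
        · simpa using h'
        · simpa using h'
      exact (congrArg (fun S => ∑ i ∈ S, s i) this).trans_le (by simpa using hs2 i₀)
    · have : (Finset.univ.filter fun i => (if i ∈ A then (0 : Fin 3) else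
          if i = i₀ then 1 else 2) = 2) = (insert i₀ A)ᶜ := by
        ext i
        simp only [Finset.mem_filter, Finset.mem_univ, true_and, Finset.mem_compl,
          Finset.mem_insert]
        split_ifs <;> simp [*]
      refine (congrArg (fun S => ∑ i ∈ S, s i) this).trans_le ?_
      have := Finset.sum_add_sum_compl (insert i₀ A) s
      linarith
  let v : Fin 3 → ℝ := fun a => ∑ i with f i = a, s i
  have hv0 : ∀ a, 0 ≤ v a := fun a => Finset.sum_nonneg fun i _ => hs i
  have hv1 : v 0 + v 1 + v 2 = 1 := by
    rw [← Fin.sum_univ_three, ← hs1]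
    exact Finset.sum_fiberwise _ _ _
  have hv2 : ∀ a, v a ≤ 1 / 2 := hf
  -- The solution for three entries: off the diagonal, `T a b` is `1 / 2` minus the third entry.
  let T : Fin 3 → Fin 3 → ℝ := fun a b => if a = b then 0 else v a + v b - 1 / 2
  have h0 := hv2 0
  have h1 := hv2 1
  have h2 := hv2 2
  have hT0 : ∀ a b, 0 ≤ T a b := by
    intro a b
    fin_cases a <;> fin_cases b <;> simp [T] <;> linarith
  have hTsymm : ∀ a b, T a b = T b a := by
    intro a b
    simp only [T, eq_comm (a := a), add_comm (v a)]
  have hTsum : ∀ a, ∑ b, T a b = v a := by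
    intro a
    rw [Fin.sum_univ_three]
    fin_cases a <;> simp [T] <;> linarith
  -- If `v b = 0`, the other two entries equal `1 / 2` and `T a b = 0`, so the default value of
  -- division is harmless.
  have hTv : ∀ a b, T a b / v b * v b = T a b := by
    intro a b
    by_cases hb : v b = 0
    · have : T a b = 0 := by
        fin_cases a <;> fin_cases b <;> simp [T] at hb ⊢ <;> linarith
      simp [this]
    · exact div_mul_cancel₀ _ hb
  -- Each block entry is distributed in proportion to `s` within the two blocks.
  refine ⟨fun i j => s i / v (f i) * (T (f i) (f j) / v (f j) * s j), fun i j => ?_, fun i j => ?_,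
    fun i => ?_, fun i => ?_⟩
  · exact mul_nonneg (div_nonneg (hs i) (hv0 _))
      (mul_nonneg (div_nonneg (hT0 _ _) (hv0 _)) (hs j))
  · dsimp only
    rw [hTsymm (f i)]
    ring
  · simp [T]
  · rw [← Finset.mul_sum, ← Finset.sum_fiberwise Finset.univ f]
    have h3 : ∀ b, ∑ j with f j = b, T (f i) (f j) / v (f j) * s j = T (f i) b := by
      intro b
      rw [← hTv (f i) b, Finset.mul_sum]
      refine Finset.sum_congr rfl fun j hj => ?_
      rw [(Finset.mem_filter.mp hj).2]
    simp_rw [h3]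
    rw [hTsum]
    by_cases hi : v (f i) = 0
    · have := (Finset.sum_eq_zero_iff_of_nonneg fun j _ => hs j).mp hi i (by simp)
      simp [this]
    · exact div_mul_cancel₀ _ hi

theorem sum_offDiag {ι : Type*} [Fintype ι] [DecidableEq ι] (w : ι → ι → ℝ)
    (hw : ∀ i, w i i = 0) (g : ι × ι → ℝ) :
    ∑ p : {p : ι × ι // p.1 ≠ p.2}, w p.1.1 p.1.2 * g p = ∑ i, ∑ j, w i j * g (i, j) := by
  rw [← Fintype.sum_prod_type' fun i j => w i j * g (i, j),
    ← Finset.sum_filter_of_ne (p := fun p : ι × ι => p.1 ≠ p.2) fun p _ hp hp' =>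
      hp (by rw [hp', hw, zero_mul])]
  exact (Finset.sum_subtype _ (by simp) fun p : ι × ι => w p.1 p.2 * g (p.1, p.2)).symm

namespace PureState

/-- The index type of the nonzero Schmidt coefficients. -/
abbrev SchmidtIndex (φ : PureState) : Type := {i : Fin φ.dimA // φ.schmidt i ≠ 0}

theorem dimA_pos (φ : PureState) : 0 < φ.dimA := by
  by_contra h
  have h1 := φ.norm_one
  have : IsEmpty (Fin φ.dimA) := ⟨fun i => h i.pos⟩
  simp at h1

theorem dimB_pos (φ : PureState) : 0 < φ.dimB := by
  by_contra h
  have h1 := φ.norm_one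
  have : IsEmpty (Fin φ.dimB) := ⟨fun i => h i.pos⟩
  simp at h1

theorem convertsTo_of_reaches {φ ψ : PureState} (h : Reaches φ.amp ψ.amp 1) :
    φ.ConvertsTo ψ := by
  obtain ⟨P, hP⟩ := h
  exact ⟨P, by rw [density_eq, density_eq, hP, Complex.ofReal_one, one_smul]⟩

theorem lt_dimA_of_schmidt_ne_zero {φ : PureState} {k : ℕ} (h : φ.schmidt k ≠ 0) : k < φ.dimA :=
  lt_of_not_ge fun h' => h (φ.schmidt_of_le h')

theorem sum_schmidtIndex (φ : PureState) (f : ℕ → ℝ) :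
    ∑ k : φ.SchmidtIndex, φ.schmidt k * f k =
      ∑ k ∈ Finset.range φ.dimA, φ.schmidt k * f k := by
  rw [← Fin.sum_univ_eq_sum_range (fun k => φ.schmidt k * f k),
    ← Finset.sum_filter_of_ne (p := fun i : Fin φ.dimA => φ.schmidt i ≠ 0) fun k _ hk hs' =>
      hk (by rw [hs', zero_mul])]
  exact (Finset.sum_subtype _ (by simp) fun k : Fin φ.dimA => φ.schmidt k * f k).symm

theorem schmidt_pos_of_ne_zero {φ : PureState} {k : ℕ} (h : φ.schmidt k ≠ 0) : 0 < φ.schmidt k :=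
  lt_of_le_of_ne (φ.schmidt_nonneg k) h.symm

theorem Equivalent.convertsTo {φ ψ : PureState} (h : φ.Equivalent ψ) : φ.ConvertsTo ψ := by
  have h' : ∀ k, φ.schmidt k = ψ.schmidt k := fun k => congrFun h k
  have hk : ∀ k : ψ.SchmidtIndex, φ.schmidt k.1 ≠ 0 :=
    fun k => by rw [h']; exact k.2
  refine convertsTo_of_reaches (Reaches.of_mixture (τ := Unit) ψ.dimA_pos ψ.dimB_pos
    φ.hasSchmidtForm ψ.hasSchmidtForm (fun i => schmidt_pos_of_ne_zero i.2)
    (fun k => ψ.schmidt_nonneg _) (fun _ => 1) (fun _ => zero_le_one) (by simp)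
    (fun _ k => ⟨⟨k.1, lt_dimA_of_schmidt_ne_zero (hk k)⟩, hk k⟩) ?_ ?_)
  · intro _ k l hkl
    simpa [Subtype.ext_iff, Fin.ext_iff] using hkl
  · intro i
    have hi : ψ.schmidt i.1 ≠ 0 := by rw [← h']; exact i.2
    let k : ψ.SchmidtIndex := ⟨⟨i.1, lt_dimA_of_schmidt_ne_zero hi⟩, hi⟩
    rw [Fintype.sum_unique, one_mul, Finset.sum_eq_single k]
    · simp [k, h']
    · intro l _ hl
      rw [if_neg]
      intro hli
      apply hl
      exact Subtype.ext (Fin.ext (congrArg (fun x => (x.1 : ℕ)) hli))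
    · simp

/-- A state whose Schmidt coefficients are at most `1 / 2` can be transformed into every
state of a `2 × d` system. -/
theorem convertsTo_of_schmidt_le_half {φ ψ : PureState} (h : φ.schmidt 0 ≤ 1 / 2)
    (hψ : ψ.dimA = 2) : φ.ConvertsTo ψ := by
  have hsum : ∑ k : φ.SchmidtIndex, φ.schmidt k = 1 := by
    have := φ.sum_schmidtIndex fun _ => 1
    rw [← Fin.sum_univ_eq_sum_range (fun k => φ.schmidt k * 1)] at this
    simpa [φ.sum_schmidt] using this
  have hμ : ψ.schmidt 0 + ψ.schmidt 1 = 1 := by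
    have := ψ.sum_schmidt
    rwa [Fin.sum_univ_eq_sum_range ψ.schmidt, hψ, Finset.sum_range_succ, Finset.sum_range_one]
      at this
  obtain ⟨w, hw0, hws, hwd, hw⟩ := exists_symm_offDiag_of_le_half
    (fun k : φ.SchmidtIndex => φ.schmidt k)
    (fun _ => φ.schmidt_nonneg _) hsum
    (fun _ => (φ.schmidt_antitone (Nat.zero_le _)).trans h)
  -- Outcome `(i, j)`, of probability `w i j`, places `ψ.schmidt 0` at `i` and `ψ.schmidt 1` at `j`.
  -- By symmetry of `w`, index `i` receives `s i * (ψ.schmidt 0 + ψ.schmidt 1) = s i`.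
  refine convertsTo_of_reaches (Reaches.of_mixture
    (τ := {p : φ.SchmidtIndex × φ.SchmidtIndex // p.1 ≠ p.2}) ψ.dimA_pos
    ψ.dimB_pos φ.hasSchmidtForm ψ.hasSchmidtForm (fun i => schmidt_pos_of_ne_zero i.2)
    (fun k => ψ.schmidt_nonneg _) (fun p => w p.1.1 p.1.2) (fun p => hw0 _ _) ?_
    (fun p k => if (k.1 : ℕ) = 0 then p.1.1 else p.1.2) ?_ ?_)
  · have := sum_offDiag w hwd fun _ => 1
    simp only [mul_one, hw] at this
    rw [this, hsum]
  · intro p k l hkl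
    have hk := k.1.2
    have hl := l.1.2
    have hp := p.2
    apply Subtype.ext
    apply Fin.ext
    dsimp only at hkl
    split_ifs at hkl with h1 h2 h2
    · omega
    · exact absurd hkl hp
    · exact absurd hkl.symm hp
    · omega
  · intro i
    have h1 : ∀ p : {p : φ.SchmidtIndex × φ.SchmidtIndex // p.1 ≠ p.2}, ∑ k : ψ.SchmidtIndex,
        (if (if (k.1 : ℕ) = 0 then p.1.1 else p.1.2) = i then ψ.schmidt k else 0) =
        ψ.schmidt 0 * (if p.1.1 = i then 1 else 0) +
          ψ.schmidt 1 * (if p.1.2 = i then 1 else 0) := by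
      intro p
      have := ψ.sum_schmidtIndex fun k => if (if k = 0 then p.1.1 else p.1.2) = i then 1 else 0
      simp only [hψ, Finset.sum_range_succ, Finset.sum_range_zero, if_true, one_ne_zero, if_false,
        zero_add] at this
      rw [← this]
      simp
    simp_rw [h1]
    rw [sum_offDiag w hwd fun p => ψ.schmidt 0 * (if p.1 = i then 1 else 0) +
      ψ.schmidt 1 * (if p.2 = i then 1 else 0)]
    simp only [mul_add, Finset.sum_add_distrib, mul_ite, mul_one, mul_zero]
    rw [Finset.sum_comm]
    simp only [Finset.sum_ite_eq', Finset.mem_univ, if_true]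
    simp_rw [← Finset.sum_mul, hws _ i]
    rw [hw, ← mul_add, hμ, mul_one]

end PureState

/-! ### Multiplicativity of the largest coefficient and of the rank -/

namespace PureState

open Polynomial in
-- Compares roots with multiplicity, so that Schmidt coefficients can be read off a diagonal form
-- without sorting it.
theorem map_schmidt_eq_of_charpoly (φ : PureState) {ι : Type*} [Fintype ι] (d : ι → ℝ)
    (h : (φ.amp * φ.ampᴴ).charpoly = ∏ i, (X - C (d i : ℂ))) :
    Multiset.map d Finset.univ.val =
      Multiset.map (fun i : Fin φ.dimA => φ.schmidt i) Finset.univ.val := by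
  have hroots : ∀ {κ : Type _} [Fintype κ] (g : κ → ℝ), (∏ i, (X - C (g i : ℂ))).roots =
      Multiset.map Complex.ofReal (Multiset.map g Finset.univ.val) := by
    intro κ _ g
    rw [Polynomial.roots_prod _ _ (by simp [Finset.prod_ne_zero_iff, Polynomial.X_sub_C_ne_zero])]
    simp
  obtain ⟨f, hf⟩ := φ.exists_perm_eigenvalues
  have h1 := (Matrix.isHermitian_mul_conjTranspose_self φ.amp).roots_charpoly_eq_eigenvalues
  rw [h, hroots] at h1
  apply Multiset.map_injective Complex.ofReal_injective
  rw [h1, ← Multiset.map_map]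
  congr 1
  simp_rw [← hf]
  conv_lhs => rw [← Multiset.map_univ_val_equiv f, Multiset.map_map]
  rfl

theorem schmidt_zero_of_charpoly (φ : PureState) {ι : Type*} [Fintype ι] (d : ι → ℝ)
    (h : (φ.amp * φ.ampᴴ).charpoly = ∏ i, (Polynomial.X - Polynomial.C (d i : ℂ))) :
    (∀ i, d i ≤ φ.schmidt 0) ∧ ∃ i, d i = φ.schmidt 0 := by
  have h1 := φ.map_schmidt_eq_of_charpoly d h
  constructor
  · intro i
    have : d i ∈ Multiset.map d Finset.univ.val := Multiset.mem_map_of_mem _ (by simp)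
    rw [h1, Multiset.mem_map] at this
    obtain ⟨k, -, hk⟩ := this
    rw [← hk]
    exact φ.schmidt_antitone (Nat.zero_le _)
  · have : φ.schmidt 0 ∈ Multiset.map (fun i : Fin φ.dimA => φ.schmidt i) Finset.univ.val :=
      Multiset.mem_map_of_mem (fun i : Fin φ.dimA => φ.schmidt i)
        (show (⟨0, φ.dimA_pos⟩ : Fin φ.dimA) ∈ Finset.univ.val by simp)
    rw [← h1, Multiset.mem_map] at this
    obtain ⟨k, -, hk⟩ := this
    exact ⟨k, hk⟩

theorem tensor_mul_conjTranspose (φ ψ : PureState) : (φ.tensor ψ).amp * (φ.tensor ψ).ampᴴ =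
    Matrix.reindex finProdFinEquiv finProdFinEquiv ((φ.amp * φ.ampᴴ) ⊗ₖ (ψ.amp * ψ.ampᴴ)) := by
  rw [Matrix.mul_kronecker_mul, ← Matrix.conjTranspose_kronecker]
  exact Matrix.submatrix_mul_equiv (φ.amp ⊗ₖ ψ.amp) (φ.amp ⊗ₖ ψ.amp)ᴴ
    finProdFinEquiv.symm finProdFinEquiv.symm finProdFinEquiv.symm

theorem exists_kronecker_diagonalization (φ ψ : PureState) :
    ∃ U : Matrix (Fin φ.dimA × Fin ψ.dimA) (Fin φ.dimA × Fin ψ.dimA) ℂ, Uᴴ * U = 1 ∧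
      (φ.amp * φ.ampᴴ) ⊗ₖ (ψ.amp * ψ.ampᴴ) =
        U * Matrix.diagonal (fun p => ((φ.schmidt p.1 * ψ.schmidt p.2 : ℝ) : ℂ)) * Uᴴ := by
  obtain ⟨U, hU, h⟩ := φ.exists_diagonalization
  obtain ⟨V, hV, h'⟩ := ψ.exists_diagonalization
  refine ⟨U ⊗ₖ V, ?_, ?_⟩
  · rw [Matrix.conjTranspose_kronecker, ← Matrix.mul_kronecker_mul, hU, hV,
      Matrix.one_kronecker_one]
  · rw [h, h', Matrix.mul_kronecker_mul, Matrix.mul_kronecker_mul,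
      Matrix.diagonal_kronecker_diagonal, Matrix.conjTranspose_kronecker]
    simp only [Complex.ofReal_mul]

/-- The spectrum of a Kronecker product consists of the products of eigenvalues, and the largest is
the product of the two largest. -/
theorem schmidt_zero_tensor (φ ψ : PureState) :
    (φ.tensor ψ).schmidt 0 = φ.schmidt 0 * ψ.schmidt 0 := by
  obtain ⟨U, hU, h⟩ := exists_kronecker_diagonalization φ ψ
  obtain ⟨h1, p, hp⟩ := (φ.tensor ψ).schmidt_zero_of_charpoly
    (fun p : Fin φ.dimA × Fin ψ.dimA => φ.schmidt p.1 * ψ.schmidt p.2) (by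
      rw [tensor_mul_conjTranspose]
      refine (Matrix.charpoly_reindex _ _).trans ?_
      rw [h, Matrix.charpoly_mul_comm, ← Matrix.mul_assoc, hU, Matrix.one_mul,
        Matrix.charpoly_diagonal])
  apply le_antisymm
  · rw [← hp]
    exact mul_le_mul (φ.schmidt_antitone (Nat.zero_le _)) (ψ.schmidt_antitone (Nat.zero_le _))
      (ψ.schmidt_nonneg _) (φ.schmidt_nonneg _)
  · exact h1 (⟨0, φ.dimA_pos⟩, ⟨0, ψ.dimA_pos⟩)

theorem rank_conj_diagonal {m : Type*} [Fintype m] [DecidableEq m] (U : Matrix m m ℂ)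
    (hU : Uᴴ * U = 1) (d : m → ℝ) :
    (U * Matrix.diagonal (fun i => (d i : ℂ)) * Uᴴ).rank = Fintype.card {i // d i ≠ 0} := by
  have hdet : IsUnit U.det := Matrix.isUnit_det_of_left_inverse hU
  have hdet' : IsUnit (Uᴴ).det := Matrix.isUnit_det_of_right_inverse hU
  rw [Matrix.rank_mul_eq_left_of_isUnit_det _ _ hdet',
    Matrix.rank_mul_eq_right_of_isUnit_det _ _ hdet, Matrix.rank_diagonal]
  exact Fintype.card_congr (Equiv.subtypeEquivRight fun i => by simp)

open scoped ComplexOrder in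
theorem rank_eq_card (φ : PureState) : φ.amp.rank = Fintype.card φ.SchmidtIndex := by
  obtain ⟨U, hU, h⟩ := φ.exists_diagonalization
  rw [← Matrix.rank_self_mul_conjTranspose, h,
    rank_conj_diagonal U hU fun i : Fin φ.dimA => φ.schmidt i]

open scoped ComplexOrder in
theorem rank_tensor (φ ψ : PureState) :
    (φ.tensor ψ).amp.rank = φ.amp.rank * ψ.amp.rank := by
  obtain ⟨U, hU, h⟩ := exists_kronecker_diagonalization φ ψ
  rw [← Matrix.rank_self_mul_conjTranspose, tensor_mul_conjTranspose]
  refine (Matrix.rank_reindex _ _ _).trans ?_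
  rw [h, rank_conj_diagonal U hU fun p => φ.schmidt p.1 * ψ.schmidt p.2, rank_eq_card, rank_eq_card,
    ← Fintype.card_prod]
  refine Fintype.card_congr (Equiv.trans (Equiv.subtypeEquivRight fun p => ?_)
    (Equiv.subtypeProdEquivProd (p := fun i : Fin φ.dimA => φ.schmidt i ≠ 0)
      (q := fun i : Fin ψ.dimA => ψ.schmidt i ≠ 0)))
  exact mul_ne_zero_iff

theorem schmidt_zero_pow (φ : PureState) (n : ℕ) :
    (φ.pow n).schmidt 0 = φ.schmidt 0 ^ n := by
  induction n with
  | zero =>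
    have := (φ.pow 0).sum_schmidt
    rw [Fin.sum_univ_eq_sum_range] at this
    simpa [pow] using this
  | succ n ih => rw [pow, schmidt_zero_tensor, ih, pow_succ]

theorem rank_pow (φ : PureState) (n : ℕ) : (φ.pow n).amp.rank = φ.amp.rank ^ n := by
  induction n with
  | zero => exact (Matrix.rank_one (n := Fin 1)).trans (by simp)
  | succ n ih => rw [pow, rank_tensor, ih, pow_succ]

theorem schmidt_zero_pos (φ : PureState) : 0 < φ.schmidt 0 := by
  refine lt_of_le_of_ne (φ.schmidt_nonneg 0) fun h => ?_
  have h1 := φ.sum_schmidt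
  rw [Finset.sum_eq_zero fun i _ => le_antisymm
    ((φ.schmidt_antitone (Nat.zero_le _)).trans h.symm.le) (φ.schmidt_nonneg _)] at h1
  exact zero_ne_one h1

theorem two_le_rank_iff_entangled (φ : PureState) : 2 ≤ φ.amp.rank ↔ φ.Entangled := by
  constructor
  · rintro h ⟨x, y, hxy⟩
    have : φ.amp = Matrix.vecMulVec x y := by
      ext i j
      exact hxy i j
    have h1 := Matrix.rank_vecMulVec_le x y
    rw [← this] at h1
    omega
  · intro h
    by_contra hlt
    apply h
    obtain ⟨W, -, hW⟩ := exists_isometry_of_rank φ.amp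
    have hsub : Subsingleton (Fin φ.amp.rank) := Fin.subsingleton_iff_le_one.mpr (by omega)
    -- The index `k` takes at most one value, so the sums pick out the only column and row, or are
    -- zero.
    refine ⟨fun i => ∑ k, W i k, fun j => ∑ k, (Wᴴ * φ.amp) k j, fun i j => ?_⟩
    conv_lhs => rw [← hW, Matrix.mul_apply]
    rw [Finset.sum_mul]
    refine Finset.sum_congr rfl fun k _ => ?_
    exact congrArg (W i k * ·) (Fintype.sum_subsingleton (fun l => (Wᴴ * φ.amp) l j) k).symm

theorem Entangled.schmidt_zero_lt_one {φ : PureState} (h : φ.Entangled) : φ.schmidt 0 < 1 := by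
  by_contra! h1
  have h2 := φ.two_le_rank_iff_entangled.mpr h
  rw [rank_eq_card] at h2
  obtain ⟨i, j, hij⟩ := Fintype.one_lt_card_iff.mp h2
  wlog hi : (i.1 : ℕ) ≠ 0 generalizing i j
  · refine this j i hij.symm fun hj => hij ?_
    apply Subtype.ext
    apply Fin.ext
    rw [hj, not_not.mp hi]
  have h3 := schmidt_pos_of_ne_zero i.2
  have h4 := φ.sum_schmidt
  have h5 : φ.schmidt 0 + φ.schmidt i.1 ≤ 1 := by
    rw [← h4]
    have hne : (⟨0, φ.dimA_pos⟩ : Fin φ.dimA) ≠ i.1 := fun h => hi (by rw [← h])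
    rw [← Finset.sum_pair (f := fun k : Fin φ.dimA => φ.schmidt k) hne]
    exact Finset.sum_le_sum_of_subset_of_nonneg (Finset.subset_univ _)
      fun _ _ _ => φ.schmidt_nonneg _
  linarith

theorem Entangled.rank_eq_two {φ : PureState} (h : φ.Entangled) (hA : φ.dimA = 2) :
    φ.amp.rank = 2 :=
  le_antisymm (hA ▸ φ.amp.rank_le_height) (φ.two_le_rank_iff_entangled.mpr h)

theorem equivalent_of_schmidt_zero_eq {φ ψ : PureState} (hφ : φ.dimA = 2) (hψ : ψ.dimA = 2)
    (h : φ.schmidt 0 = ψ.schmidt 0) : φ.Equivalent ψ := by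
  have h1 := φ.sum_schmidt
  have h2 := ψ.sum_schmidt
  rw [Fin.sum_univ_eq_sum_range φ.schmidt, hφ, Finset.sum_range_succ, Finset.sum_range_one] at h1
  rw [Fin.sum_univ_eq_sum_range ψ.schmidt, hψ, Finset.sum_range_succ, Finset.sum_range_one] at h2
  ext k
  match k with
  | 0 => exact h
  | 1 => linarith
  | k + 2 => rw [φ.schmidt_of_le (by omega), ψ.schmidt_of_le (by omega)]

/-! ### Two-level states -/

/-- The state `√c |00⟩ + √(1 - c) |11⟩` of a `2 × d` system. -/
def twoLevel (d : ℕ) (hd : 2 ≤ d) (c : ℝ) (h0 : 0 ≤ c) (h1 : c ≤ 1) : PureState where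
  dimA := 2
  dimB := d
  amp := Matrix.of fun i j => if j = Fin.castLE hd i then ((√(![c, 1 - c] i) : ℝ) : ℂ) else 0
  norm_one := by
    have h2 : 0 ≤ 1 - c := by linarith
    simp [apply_ite, h0, h2]

variable {d : ℕ} {hd : 2 ≤ d} {c : ℝ} {h0 : 0 ≤ c} {h1 : c ≤ 1}

theorem schmidt_zero_twoLevel (hc : 1 / 2 ≤ c) :
    (twoLevel d hd c h0 h1).schmidt 0 = c := by
  have hpos : ∀ i, 0 ≤ ![c, 1 - c] i := by
    intro i
    fin_cases i <;> simp <;> linarith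
  let M : Matrix (Fin 2) (Fin d) ℂ :=
    Matrix.of fun i j => if j = Fin.castLE hd i then ((√(![c, 1 - c] i) : ℝ) : ℂ) else 0
  have hM : M * Mᴴ = Matrix.diagonal fun i : Fin 2 => ((![c, 1 - c] i : ℝ) : ℂ) := by
    ext i j
    have hij : Fin.castLE hd i = Fin.castLE hd j ↔ i = j := by simp
    have h3 := Real.mul_self_sqrt (hpos i)
    simp only [M, Matrix.mul_apply, Matrix.conjTranspose_apply, Matrix.of_apply,
      Matrix.diagonal_apply, ite_mul, zero_mul, Finset.sum_ite_eq', Finset.mem_univ, if_true, hij]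
    split_ifs with h
    · subst h
      rw [Complex.star_def, Complex.conj_ofReal, ← Complex.ofReal_mul, h3]
    · simp
  obtain ⟨h2, i, hi⟩ := (twoLevel d hd c h0 h1).schmidt_zero_of_charpoly ![c, 1 - c]
    ((congrArg Matrix.charpoly hM).trans (Matrix.charpoly_diagonal _))
  have h3 := h2 0
  simp only [Matrix.cons_val_zero] at h3
  refine le_antisymm ?_ h3
  rw [← hi]
  fin_cases i <;> simp
  linarith

theorem entangled_twoLevel (hc0 : 0 < c) (hc1 : c < 1) :
    (twoLevel d hd c h0 h1).Entangled := by
  rintro ⟨x, y, h⟩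
  have h' : ∀ (i : Fin 2) (j : Fin d),
      (if j = Fin.castLE hd i then ((√(![c, 1 - c] i) : ℝ) : ℂ) else 0) = x i * y j := h
  have h00 := h' 0 (Fin.castLE hd 0)
  have h01 := h' 0 (Fin.castLE hd 1)
  have h11 := h' 1 (Fin.castLE hd 1)
  simp only [Fin.castLE_inj, if_true, Matrix.cons_val_zero, Matrix.cons_val_one, one_ne_zero,
    if_false] at h00 h01 h11
  have e0 : ((√c : ℝ) : ℂ) ≠ 0 := by exact_mod_cast (Real.sqrt_pos.mpr hc0).ne'
  have e1 : ((√(1 - c) : ℝ) : ℂ) ≠ 0 := by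
    exact_mod_cast (Real.sqrt_pos.mpr (sub_pos.mpr hc1)).ne'
  rcases mul_eq_zero.mp h01.symm with h2 | h2
  · rw [h2, zero_mul] at h00
    exact e0 h00
  · rw [h2, mul_zero] at h11
    exact e1 h11

/-! ### Rate bounds and the gap -/

/-- The bounds on transformation rates given by the Schmidt rank and the largest Schmidt
coefficient. -/
theorem ConvertsTo.rate_le {φ ψ : PureState} (hφ : φ.Entangled) (hψ : ψ.Entangled) {n m : ℕ}
    (h : (φ.pow n).ConvertsTo (ψ.pow m)) :
    m * Real.log ψ.amp.rank ≤ n * Real.log φ.amp.rank ∧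
      m * -Real.log (ψ.schmidt 0) ≤ n * -Real.log (φ.schmidt 0) := by
  have hr := φ.two_le_rank_iff_entangled.mpr hφ
  have hr' := ψ.two_le_rank_iff_entangled.mpr hψ
  constructor
  · have h1 := h.rank_le
    rw [rank_pow, rank_pow] at h1
    have h2 : ((ψ.amp.rank : ℝ)) ^ m ≤ (φ.amp.rank : ℝ) ^ n := by exact_mod_cast h1
    have h3 := Real.log_le_log (by positivity) h2
    rwa [Real.log_pow, Real.log_pow] at h3
  · have h1 := h.sum_schmidt_le 1
    rw [Finset.sum_range_one, Finset.sum_range_one, schmidt_zero_pow, schmidt_zero_pow] at h1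
    have h3 := Real.log_le_log (pow_pos φ.schmidt_zero_pos n) h1
    rw [Real.log_pow, Real.log_pow] at h3
    linarith

theorem Entangled.log_rank_pos {φ : PureState} (h : φ.Entangled) : 0 < Real.log φ.amp.rank :=
  Real.log_pos (by exact_mod_cast φ.two_le_rank_iff_entangled.mpr h)

theorem Entangled.neg_log_schmidt_pos {φ : PureState} (h : φ.Entangled) :
    0 < -Real.log (φ.schmidt 0) :=
  neg_pos.mpr (Real.log_neg φ.schmidt_zero_pos h.schmidt_zero_lt_one)

theorem lowerSet_le {φ ψ : PureState} (hφ : φ.Entangled) (hψ : ψ.Entangled) {x : ℝ}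
    (hx : x ∈ φ.lowerSet ψ) : x ≤ min (Real.log φ.amp.rank / Real.log ψ.amp.rank)
      (-Real.log (φ.schmidt 0) / -Real.log (ψ.schmidt 0)) := by
  obtain ⟨n, m, hn, hm, rfl, h⟩ := hx
  obtain ⟨h1, h2⟩ := h.rate_le hφ hψ
  have hn' : (0 : ℝ) < n := by exact_mod_cast hn
  refine le_min ?_ ?_
  · rw [div_le_div_iff₀ hn' hψ.log_rank_pos]
    linarith
  · rw [div_le_div_iff₀ hn' hψ.neg_log_schmidt_pos]
    linarith

theorem le_upperSet {φ ψ : PureState} (hφ : φ.Entangled) (hψ : ψ.Entangled) {x : ℝ}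
    (hx : x ∈ φ.upperSet ψ) : max (Real.log φ.amp.rank / Real.log ψ.amp.rank)
      (-Real.log (φ.schmidt 0) / -Real.log (ψ.schmidt 0)) ≤ x := by
  obtain ⟨n, m, hn, hm, rfl, h⟩ := hx
  obtain ⟨h1, h2⟩ := h.rate_le hψ hφ
  have hn' : (0 : ℝ) < n := by exact_mod_cast hn
  refine max_le ?_ ?_
  · rw [div_le_div_iff₀ hψ.log_rank_pos hn']
    linarith
  · rw [div_le_div_iff₀ hψ.neg_log_schmidt_pos hn']
    linarith

/-- `schmidt 0 ^ n` tends to zero, so some power has all Schmidt coefficients at most `1 / 2`. -/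
theorem Entangled.exists_pow_convertsTo {φ ψ : PureState} (hφ : φ.Entangled)
    (hψ : ψ.dimA = 2) : ∃ n : ℕ, 0 < n ∧ (φ.pow n).ConvertsTo (ψ.pow 1) := by
  obtain ⟨n, hn⟩ := exists_pow_lt_of_lt_one (show (0 : ℝ) < 1 / 2 by norm_num)
    hφ.schmidt_zero_lt_one
  refine ⟨n, Nat.pos_of_ne_zero fun h0 => ?_, convertsTo_of_schmidt_le_half ?_ ?_⟩
  · rw [h0] at hn
    norm_num at hn
  · rw [schmidt_zero_pow]
    exact hn.le
  · simp [pow, tensor, hψ]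

theorem rate_gap {φ ψ : PureState} (hφA : φ.dimA = 2) (hψA : ψ.dimA = 2) (hφ : φ.Entangled)
    (hψ : ψ.Entangled) (hne : ¬ φ.Equivalent ψ) :
    (φ.lowerSet ψ).Nonempty ∧ BddAbove (φ.lowerSet ψ) ∧
      (φ.upperSet ψ).Nonempty ∧ BddBelow (φ.upperSet ψ) ∧
      sSup (φ.lowerSet ψ) < sInf (φ.upperSet ψ) ∧
      (∀ n m : ℕ, 0 < n → 0 < m → sSup (φ.lowerSet ψ) < (m : ℝ) / n →
        (m : ℝ) / n < sInf (φ.upperSet ψ) → (φ.pow n).Incomparable (ψ.pow m)) ∧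
      ∃ n m : ℕ, 0 < n ∧ 0 < m ∧ sSup (φ.lowerSet ψ) < (m : ℝ) / n ∧
        (m : ℝ) / n < sInf (φ.upperSet ψ) := by
  obtain ⟨n₁, hn₁, hc₁⟩ := hφ.exists_pow_convertsTo hψA
  obtain ⟨n₂, hn₂, hc₂⟩ := hψ.exists_pow_convertsTo hφA
  have hLmem : ((1 : ℕ) : ℝ) / n₁ ∈ φ.lowerSet ψ := ⟨n₁, 1, hn₁, one_pos, rfl, hc₁⟩
  have hL : (φ.lowerSet ψ).Nonempty := ⟨_, hLmem⟩
  have hU : (φ.upperSet ψ).Nonempty := ⟨_, 1, n₂, one_pos, hn₂, rfl, hc₂⟩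
  have hLb : BddAbove (φ.lowerSet ψ) := ⟨_, fun x hx => lowerSet_le hφ hψ hx⟩
  have hUb : BddBelow (φ.upperSet ψ) := ⟨_, fun x hx => le_upperSet hφ hψ hx⟩
  have hgap : sSup (φ.lowerSet ψ) < sInf (φ.upperSet ψ) := by
    refine (csSup_le hL fun x hx => lowerSet_le hφ hψ hx).trans_lt
      (lt_of_lt_of_le ?_ (le_csInf hU fun x hx => le_upperSet hφ hψ hx))
    -- Both ranks are 2, so the gap closes only if the ratio of `-log (schmidt 0)` is also 1.
    rw [hφ.rank_eq_two hφA, hψ.rank_eq_two hψA, min_lt_max,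
      div_self (Real.log_pos (by norm_num)).ne']
    intro h
    rw [eq_comm, div_eq_one_iff_eq hψ.neg_log_schmidt_pos.ne', neg_inj] at h
    exact hne (equivalent_of_schmidt_zero_eq hφA hψA
      (Real.log_injOn_pos φ.schmidt_zero_pos ψ.schmidt_zero_pos h))
  refine ⟨hL, hLb, hU, hUb, hgap, fun n m hn hm h1 h2 => ⟨fun h => ?_, fun h => ?_⟩, ?_⟩
  · exact absurd (le_csSup hLb ⟨n, m, hn, hm, rfl, h⟩) h1.not_ge
  · exact absurd (csInf_le hUb ⟨n, m, hn, hm, rfl, h⟩) h2.not_ge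
  -- A rational in the gap exceeds `1 / n₁ ∈ L`, hence has a positive numerator.
  · obtain ⟨q, hq1, hq2⟩ := exists_rat_btwn hgap
    have hq0 : (0 : ℝ) < q :=
      lt_of_lt_of_le (div_pos (by norm_num) (by exact_mod_cast hn₁))
        ((le_csSup hLb hLmem).trans hq1.le)
    have hq0' : 0 < q := by exact_mod_cast hq0
    have hq : (q : ℝ) = (q.num.toNat : ℝ) / q.den := by
      have h3 : ((q.num.toNat : ℤ) : ℝ) = q.num := by
        rw [Int.toNat_of_nonneg (Rat.num_pos.mpr hq0').le]
      rw [← Int.cast_natCast, h3]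
      exact Rat.cast_def q
    rw [hq] at hq1 hq2
    exact ⟨q.den, q.num.toNat, q.den_pos, by have := Rat.num_pos.mpr hq0'; omega, hq1, hq2⟩

/-! ### Incomparable states and the absence of Dedekind cuts -/

theorem IsTwoByTensor.pow {d : ℕ} {φ : PureState} (hA : φ.dimA = 2) (hB : φ.dimB = d) {n : ℕ}
    (hn : 0 < n) : IsTwoByTensor d (φ.pow n) := by
  induction n, hn using Nat.le_induction with
  | base => exact .single _ ((one_mul _).trans hA) ((one_mul _).trans hB)
  | succ n hn ih => exact .tensor _ _ ih (.single _ hA hB)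

theorem exists_pair_twoLevel (d : ℕ) (hd : 2 ≤ d) : ∃ φ ψ : PureState, φ.dimA = 2 ∧ φ.dimB = d ∧
    ψ.dimA = 2 ∧ ψ.dimB = d ∧ φ.Entangled ∧ ψ.Entangled ∧ φ.schmidt 0 ≠ ψ.schmidt 0 :=
  ⟨twoLevel d hd (1 / 2) (by norm_num) (by norm_num),
    twoLevel d hd (2 / 3) (by norm_num) (by norm_num), rfl, rfl, rfl, rfl,
    entangled_twoLevel (by norm_num) (by norm_num), entangled_twoLevel (by norm_num) (by norm_num),
    by rw [schmidt_zero_twoLevel (by norm_num), schmidt_zero_twoLevel (by norm_num)]; norm_num⟩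

theorem exists_incomparable (d : ℕ) (hd : 2 ≤ d) : ∃ φ ψ : PureState,
    IsTwoByTensor d φ ∧ IsTwoByTensor d ψ ∧ φ.Incomparable ψ := by
  obtain ⟨φ, ψ, hφA, hφB, hψA, hψB, hφ, hψ, hne⟩ := exists_pair_twoLevel d hd
  obtain ⟨-, -, -, -, -, hinc, n, m, hn, hm, h1, h2⟩ :=
    rate_gap hφA hψA hφ hψ fun h => hne (congrFun h 0)
  exact ⟨φ.pow n, ψ.pow m, .pow hφA hφB hn, .pow hψA hψB hm, hinc n m hn hm h1 h2⟩

/-- Powers of a product reference have rank at most 1 and never reach powers of an entangled `φ`.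
Then `U` is empty, and the empty set has no greatest lower bound in `ℝ`. -/
theorem IsDedekindCut.entangled {φ e : PureState} {s : ℝ} (hφ : φ.Entangled)
    (h : φ.IsDedekindCut e s) : e.Entangled := by
  by_contra he
  rw [← two_le_rank_iff_entangled, not_le] at he
  have hU : φ.upperSet e = ∅ := by
    rw [Set.eq_empty_iff_forall_notMem]
    rintro x ⟨n, m, hn, hm, -, hc⟩
    have h1 := hc.rank_le
    rw [rank_pow, rank_pow] at h1
    have h2 : 1 < φ.amp.rank ^ n :=
      Nat.one_lt_pow hn.ne' (φ.two_le_rank_iff_entangled.mpr hφ)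
    have h3 : e.amp.rank ^ m ≤ 1 ^ m := Nat.pow_le_pow_left (by omega) m
    rw [one_pow] at h3
    omega
  have h2 := h.2
  rw [hU] at h2
  have h3 : s + 1 ≤ s := h2.2 (by simp [lowerBounds])
  linarith

/-- The cut is at most the minimum of the two ratios and at least their maximum. -/
theorem IsDedekindCut.log_rank_div_eq {φ e : PureState} {s : ℝ} (hφ : φ.Entangled)
    (he : e.Entangled) (h : φ.IsDedekindCut e s) :
    Real.log φ.amp.rank / Real.log e.amp.rank =
      -Real.log (φ.schmidt 0) / -Real.log (e.schmidt 0) := by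
  have h1 := h.1.2 fun x hx => lowerSet_le hφ he hx
  have h2 := h.2.2 fun x hx => le_upperSet hφ he hx
  exact inf_eq_sup.mp (le_antisymm min_le_max (h2.trans h1))

theorem not_exists_dedekindCut (d : ℕ) (hd : 2 ≤ d) (e : PureState) :
    ¬ ∃ S : PureState → ℝ, ∀ φ : PureState, φ.dimA = 2 → φ.dimB = d → φ.Entangled →
        IsDedekindCut φ e (S φ) := by
  rintro ⟨S, hS⟩
  obtain ⟨φ, ψ, hφA, hφB, hψA, hψB, hφ, hψ, hne⟩ := exists_pair_twoLevel d hd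
  have h1 := hS φ hφA hφB hφ
  have h2 := hS ψ hψA hψB hψ
  have he := h1.entangled hφ
  have h3 := h1.log_rank_div_eq hφ he
  have h4 := h2.log_rank_div_eq hψ he
  rw [hφ.rank_eq_two hφA] at h3
  rw [hψ.rank_eq_two hψA, h3, div_left_inj' he.neg_log_schmidt_pos.ne', neg_inj] at h4
  exact hne (Real.log_injOn_pos φ.schmidt_zero_pos ψ.schmidt_zero_pos h4)

end PureState

end

theorem mainTheorem4 :
    -- the transition relation is a partial order up to equivalence
    (∀ φ : PureState, φ.ConvertsTo φ) ∧
    (∀ φ ψ χ : PureState, φ.ConvertsTo ψ → ψ.ConvertsTo χ → φ.ConvertsTo χ) ∧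
    (∀ φ ψ : PureState, (φ.ConvertsTo ψ ∧ ψ.ConvertsTo φ) ↔ φ.Equivalent ψ) ∧
    -- it is not total on the `2 × d` states and their tensor products
    (∀ d : ℕ, 2 ≤ d → ∃ φ ψ : PureState,
      PureState.IsTwoByTensor d φ ∧ PureState.IsTwoByTensor d ψ ∧ φ.Incomparable ψ) ∧
    -- for inequivalent entangled `φ`, `ψ` there is a gap between `L(φ|ψ)` and `U(φ|ψ)`, and
    -- suitable powers of `φ` and `ψ` are incomparable
    (∀ φ ψ : PureState, φ.dimA = 2 → ψ.dimA = 2 → φ.Entangled → ψ.Entangled → ¬ φ.Equivalent ψ →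
      (φ.lowerSet ψ).Nonempty ∧ BddAbove (φ.lowerSet ψ) ∧
      (φ.upperSet ψ).Nonempty ∧ BddBelow (φ.upperSet ψ) ∧
      sSup (φ.lowerSet ψ) < sInf (φ.upperSet ψ) ∧
      (∀ n m : ℕ, 0 < n → 0 < m → sSup (φ.lowerSet ψ) < (m : ℝ) / n →
        (m : ℝ) / n < sInf (φ.upperSet ψ) → (φ.pow n).Incomparable (ψ.pow m)) ∧
      ∃ n m : ℕ, 0 < n ∧ 0 < m ∧ sSup (φ.lowerSet ψ) < (m : ℝ) / n ∧
        (m : ℝ) / n < sInf (φ.upperSet ψ)) ∧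
    -- whatever the reference state, no entropy is defined as a Dedekind cut
    (∀ d : ℕ, 2 ≤ d → ∀ e : PureState, PureState.IsTwoByTensor d e →
      ¬ ∃ S : PureState → ℝ, ∀ φ : PureState, φ.dimA = 2 → φ.dimB = d → φ.Entangled →
        PureState.IsDedekindCut φ e (S φ)) :=
  ⟨PureState.convertsTo_refl, fun _ _ _ => PureState.ConvertsTo.trans,
    fun _ _ => ⟨fun h => PureState.equivalent_of_convertsTo h.1 h.2,
      fun h => ⟨h.convertsTo, PureState.Equivalent.convertsTo (Eq.symm h)⟩⟩,
    PureState.exists_incomparable, fun _ _ => PureState.rate_gap,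
    fun d hd e _ => PureState.not_exists_dedekindCut d hd e⟩
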